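/- Let $D<-3$ be a squarefree integer, $K=\mathbb Q(\sqrt D)$ with ring of integers $\mathcal O$, and let $\Lambda$ be a free $\mathcal O$-module of rank $n+1$ ($n\ge 1$) with a $K$-valued hermitian form $h$ of signature $(n,1)$. Let $\Gamma$ be a subgroup of finite index in the group $U(\Lambda)$ of $\mathcal O$-linear isometries of $\Lambda$. Let $F$ be a cusp, i.e. an isotropic line $E\subset\Lambda\otimes_{\mathcal O}K$, and let $b_1,\dots,b_{n+1}$ be a basis of $\Lambda\otimes_{\mathcal O} K$ with $b_1\in E$ in which the Gram matrix of $h$ is $\begin{pmatrix}0&0&a\\0&B&0\\ \bar a&0&0\end{pmatrix}$. Let $N(F)$ be the stabiliser of the line $E\otimes_K\mathbb C$ in the unitary group of $(\Lambda\otimes_{\mathcal O}\mathbb C,h)$, let $U(F)$ be the centre of its unipotent radical (the set of unipotent elements of $N(F)$), and put $N(F)_{\mathbb Z}=N(F)\cap\Gamma$, $U(F)_{\mathbb Z}=U(F)\cap\Gamma$, $G(F)=N(F)_{\mathbb Z}/U(F)_{\mathbb Z}$. In the basis $(b_i)$ elements of $N(F)$ have the form $g=\begin{pmatrix}u&v&w\\0&X&y\\0&0&z\end{pmatrix}$,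 and $U(F)_{\mathbb Z}$ acts on the affine coordinates $(\alpha,\underline w)\in\mathbb C\times\mathbb C^{n-1}$ (the points $[\alpha:\underline w:1]$) of complex hyperbolic space $\mathbb CH^n=\{[\omega]:h(\omega,\omega)<0\}$ by the translations $\alpha\mapsto\alpha+k\sigma$, $k\in\mathbb Z$, where $\sigma=iax_0$ with $x_0>0$. With $\theta=e^{2\pi i\alpha/\sigma}$, the quotient $\mathbb CH^n/U(F)_{\mathbb Z}$ is an open subset of $\mathbb C^*\times\mathbb C^{n-1}$; the toroidal partial compactification is obtained by adding the boundary $\{0\}\times\mathbb C^{n-1}$, and $g\in G(F)$ acts on it by $$(\theta,\underline w)\mapsto\Bigl(\theta\, e^{\frac{2\pi i}{\sigma}\cdot\frac{v\underline w+w}{z}},\ \tfrac1z(X\underline w+y)\Bigr).$$ Let $g\in G(F)$ act non-trivially on this partial compactification (in particular $g$ is not the class of $-1$) and fix the boundary point $(0,\underline w_0)$. Suppose that no power of $g$ acts as a quasi-reflection on the tangent space $\mathbb C^n$ at $(0,\underline w_0)$, i.e. no power acts there as an automorphism of finite order with exactly one eigenvalue (with multiplicity) different from $1$. Then $g$ has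 finite order $m$ in $G(F)$, and $\Sigma(g)\ge 1$: for every primitive $m$-th root of unity $\zeta$, if $\zeta^{a_1},\dots,\zeta^{a_n}$ with $0\le a_i<m$ are the eigenvalues of the action of $g$ on the tangent space at $(0,\underline w_0)$, then $$\Sigma(g)=\sum_{i=1}^n\frac{a_i}{m}\ \ge\ 1 .$$ -/

import Mathlib

open scoped Matrix NumberField

namespace BallQuotient

noncomputable section

/-- The imaginary quadratic field `ℚ(√D)` (for `D < 0`), as a subfield of `ℂ`. -/
def quadField (D : ℤ) : IntermediateField ℚ ℂ :=
  IntermediateField.adjoin ℚ {Complex.I * ((Real.sqrt (-(D : ℝ)) : ℝ) : ℂ)}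

/-- A hermitian lattice of signature `(n,1)` over the ring of integers `𝒪` of `ℚ(√D)`:
the free module `Λ = 𝒪^(n+1)` with the hermitian form `h(x,y) = yᴴ H x`, where `H = form` has
entries in `ℚ(√D)` and is congruent over `ℂ` to `diag(1,…,1,-1)`. -/
structure HermitianLattice (D : ℤ) (n : ℕ) where
  form : Matrix (Fin (n + 1)) (Fin (n + 1)) (quadField D)
  signature : ∃ T : GL (Fin (n + 1)) ℂ,
    (T : Matrix (Fin (n + 1)) (Fin (n + 1)) ℂ)ᴴ * form.map (algebraMap (quadField D) ℂ) *
        (T : Matrix (Fin (n + 1)) (Fin (n + 1)) ℂ) =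
      Matrix.diagonal (Fin.snoc (fun _ : Fin n => (1 : ℂ)) (-1 : ℂ))

namespace HermitianLattice

variable {D : ℤ} {n : ℕ}

/-- The hermitian form on `Λ ⊗ ℂ = ℂ^(n+1)`, as a complex matrix. -/
def formC (L : HermitianLattice D n) : Matrix (Fin (n + 1)) (Fin (n + 1)) ℂ :=
  L.form.map (algebraMap (quadField D) ℂ)

/-- The real Lie group of all complex linear isometries of `(Λ ⊗ ℂ, h)`, a copy of `U(n,1)`. -/
def realUnitary (L : HermitianLattice D n) : Subgroup (GL (Fin (n + 1)) ℂ) where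
  carrier := {g | (g : Matrix (Fin (n + 1)) (Fin (n + 1)) ℂ)ᴴ * L.formC *
    (g : Matrix (Fin (n + 1)) (Fin (n + 1)) ℂ) = L.formC}
  one_mem' := by simp
  mul_mem' := by
    intro g k hg hk
    simp only [Set.mem_ofPred_eq, Units.val_mul, Matrix.conjTranspose_mul] at *
    calc _ = (k : Matrix (Fin (n + 1)) (Fin (n + 1)) ℂ)ᴴ *
          ((g : Matrix (Fin (n + 1)) (Fin (n + 1)) ℂ)ᴴ * L.formC *
            (g : Matrix (Fin (n + 1)) (Fin (n + 1)) ℂ)) *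
          (k : Matrix (Fin (n + 1)) (Fin (n + 1)) ℂ) := by simp only [Matrix.mul_assoc]
      _ = _ := by rw [hg, hk]
  inv_mem' := by
    intro g hg
    simp only [Set.mem_ofPred_eq] at *
    have h1 : (g : Matrix (Fin (n + 1)) (Fin (n + 1)) ℂ) *
        ((g⁻¹ : GL (Fin (n + 1)) ℂ) : Matrix (Fin (n + 1)) (Fin (n + 1)) ℂ) = 1 := by
      rw [← Units.val_mul, mul_inv_cancel, Units.val_one]
    have h2 : ((g⁻¹ : GL (Fin (n + 1)) ℂ) : Matrix (Fin (n + 1)) (Fin (n + 1)) ℂ)ᴴ *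
        (g : Matrix (Fin (n + 1)) (Fin (n + 1)) ℂ)ᴴ = 1 := by
      rw [← Matrix.conjTranspose_mul, h1, Matrix.conjTranspose_one]
    calc _ = ((g⁻¹ : GL (Fin (n + 1)) ℂ) : Matrix (Fin (n + 1)) (Fin (n + 1)) ℂ)ᴴ *
          ((g : Matrix (Fin (n + 1)) (Fin (n + 1)) ℂ)ᴴ * L.formC *
            (g : Matrix (Fin (n + 1)) (Fin (n + 1)) ℂ)) *
          ((g⁻¹ : GL (Fin (n + 1)) ℂ) : Matrix (Fin (n + 1)) (Fin (n + 1)) ℂ) := by rw [hg]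
      _ = (((g⁻¹ : GL (Fin (n + 1)) ℂ) : Matrix (Fin (n + 1)) (Fin (n + 1)) ℂ)ᴴ *
          (g : Matrix (Fin (n + 1)) (Fin (n + 1)) ℂ)ᴴ) * L.formC *
            ((g : Matrix (Fin (n + 1)) (Fin (n + 1)) ℂ) *
          ((g⁻¹ : GL (Fin (n + 1)) ℂ) : Matrix (Fin (n + 1)) (Fin (n + 1)) ℂ)) := by
            simp only [Matrix.mul_assoc]
      _ = L.formC := by rw [h1, h2, one_mul, mul_one]

/-- `U(Λ)`: the `𝒪`-linear automorphisms of `Λ = 𝒪^(n+1)` that preserve `h`. -/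
def unitaryGroup (L : HermitianLattice D n) : Subgroup (GL (Fin (n + 1)) ℂ) :=
  L.realUnitary ⊓
    (Matrix.GeneralLinearGroup.map (n := Fin (n + 1)) (algebraMap (𝓞 (quadField D)) ℂ)).range

end HermitianLattice

/-! ### Groups attached to a line -/

section Line

variable {D : ℤ} {n : ℕ}

/-- `N(F)`: the stabiliser in `U(n,1)` of the complex line spanned by `e`. -/
def lineStabilizer (L : HermitianLattice D n) (e : Fin (n + 1) → ℂ) :
    Subgroup (GL (Fin (n + 1)) ℂ) where
  carrier := {g | g ∈ L.realUnitary ∧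
    ∃ c : ℂ, c ≠ 0 ∧ (g : Matrix (Fin (n + 1)) (Fin (n + 1)) ℂ) *ᵥ e = c • e}
  one_mem' := ⟨one_mem _, 1, one_ne_zero, by simp⟩
  mul_mem' := by
    rintro g k ⟨hg, c, hc, hce⟩ ⟨hk, d, hd, hde⟩
    refine ⟨mul_mem hg hk, c * d, mul_ne_zero hc hd, ?_⟩
    rw [Units.val_mul, ← Matrix.mulVec_mulVec, hde, Matrix.mulVec_smul, hce, smul_smul, mul_comm]
  inv_mem' := by
    rintro g ⟨hg, c, hc, hce⟩
    refine ⟨inv_mem hg, c⁻¹, inv_ne_zero hc, ?_⟩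
    have h : ((g⁻¹ : GL (Fin (n + 1)) ℂ) : Matrix (Fin (n + 1)) (Fin (n + 1)) ℂ) *ᵥ
        ((g : Matrix (Fin (n + 1)) (Fin (n + 1)) ℂ) *ᵥ e) = e := by
      rw [Matrix.mulVec_mulVec, ← Units.val_mul, inv_mul_cancel, Units.val_one, Matrix.one_mulVec]
    rw [hce, Matrix.mulVec_smul] at h
    rw [eq_inv_smul_iff₀ hc, h]

/-- `W(F)`: the unipotent elements of `N(F)`. -/
def unipotentRadical (L : HermitianLattice D n) (e : Fin (n + 1) → ℂ) :
    Set (GL (Fin (n + 1)) ℂ) :=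
  {g | g ∈ lineStabilizer L e ∧
    IsNilpotent ((g : Matrix (Fin (n + 1)) (Fin (n + 1)) ℂ) - 1)}

theorem conj_mem_unipotentRadical {L : HermitianLattice D n} {e : Fin (n + 1) → ℂ}
    {g k : GL (Fin (n + 1)) ℂ} (hg : g ∈ lineStabilizer L e) (hk : k ∈ unipotentRadical L e) :
    g * k * g⁻¹ ∈ unipotentRadical L e := by
  refine ⟨mul_mem (mul_mem hg hk.1) (inv_mem hg), ?_⟩
  obtain ⟨r, hr⟩ := hk.2
  refine ⟨r, ?_⟩
  have h : ((g * k * g⁻¹ : GL (Fin (n + 1)) ℂ) : Matrix (Fin (n + 1)) (Fin (n + 1)) ℂ) - 1 =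
      (g : Matrix (Fin (n + 1)) (Fin (n + 1)) ℂ) *
        ((k : Matrix (Fin (n + 1)) (Fin (n + 1)) ℂ) - 1) *
        ((g⁻¹ : GL (Fin (n + 1)) ℂ) : Matrix (Fin (n + 1)) (Fin (n + 1)) ℂ) := by
    rw [mul_sub, sub_mul, mul_one, Units.val_mul, Units.val_mul, ← Units.val_mul g g⁻¹,
      mul_inv_cancel, Units.val_one]
  rw [h, Units.conj_pow, hr, mul_zero, zero_mul]

/-- `U(F)`: the centre of `W(F)`. -/
def centerUnipotent (L : HermitianLattice D n) (e : Fin (n + 1) → ℂ) :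
    Subgroup (GL (Fin (n + 1)) ℂ) where
  carrier := {g | g ∈ unipotentRadical L e ∧ ∀ k ∈ unipotentRadical L e, g * k = k * g}
  one_mem' := ⟨⟨one_mem _, by simp⟩, by simp⟩
  mul_mem' := by
    rintro g k ⟨hg, hgc⟩ ⟨hk, hkc⟩
    refine ⟨⟨mul_mem hg.1 hk.1, ?_⟩, fun l hl => ?_⟩
    · have hc : Commute (g : Matrix (Fin (n + 1)) (Fin (n + 1)) ℂ)
          (k : Matrix (Fin (n + 1)) (Fin (n + 1)) ℂ) := by
        have := congrArg Units.val (hgc k hk)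
        simpa [Commute, SemiconjBy] using this
      have h : ((g * k : GL (Fin (n + 1)) ℂ) : Matrix (Fin (n + 1)) (Fin (n + 1)) ℂ) - 1 =
          ((g : Matrix (Fin (n + 1)) (Fin (n + 1)) ℂ) - 1) *
            (k : Matrix (Fin (n + 1)) (Fin (n + 1)) ℂ) +
            ((k : Matrix (Fin (n + 1)) (Fin (n + 1)) ℂ) - 1) := by
        rw [Units.val_mul]; noncomm_ring
      have c1 : Commute ((g : Matrix (Fin (n + 1)) (Fin (n + 1)) ℂ) - 1)
          (k : Matrix (Fin (n + 1)) (Fin (n + 1)) ℂ) := hc.sub_left (Commute.one_left _)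
      have c2 : Commute ((g : Matrix (Fin (n + 1)) (Fin (n + 1)) ℂ) - 1)
          ((k : Matrix (Fin (n + 1)) (Fin (n + 1)) ℂ) - 1) := c1.sub_right (Commute.one_right _)
      have c3 : Commute (k : Matrix (Fin (n + 1)) (Fin (n + 1)) ℂ)
          ((k : Matrix (Fin (n + 1)) (Fin (n + 1)) ℂ) - 1) :=
        (Commute.refl _).sub_right (Commute.one_right _)
      rw [h]
      exact (c2.mul_left c3).isNilpotent_add (c1.isNilpotent_mul_right hg.2) hk.2
    · rw [mul_assoc, hkc l hl, ← mul_assoc, hgc l hl, mul_assoc]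
  inv_mem' := by
    rintro g ⟨hg, hgc⟩
    refine ⟨⟨inv_mem hg.1, ?_⟩, fun k hk => ?_⟩
    · have h : ((g⁻¹ : GL (Fin (n + 1)) ℂ) : Matrix (Fin (n + 1)) (Fin (n + 1)) ℂ) - 1 =
          -(((g : Matrix (Fin (n + 1)) (Fin (n + 1)) ℂ) - 1) *
          ((g⁻¹ : GL (Fin (n + 1)) ℂ) : Matrix (Fin (n + 1)) (Fin (n + 1)) ℂ)) := by
        rw [sub_mul, ← Units.val_mul, mul_inv_cancel, Units.val_one, one_mul, neg_sub]
      have c : Commute ((g : Matrix (Fin (n + 1)) (Fin (n + 1)) ℂ) - 1)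
          ((g⁻¹ : GL (Fin (n + 1)) ℂ) : Matrix (Fin (n + 1)) (Fin (n + 1)) ℂ) := by
        refine Commute.sub_left ?_ (Commute.one_left _)
        rw [Commute, SemiconjBy, ← Units.val_mul, ← Units.val_mul, mul_inv_cancel, inv_mul_cancel]
      rw [h]
      exact (c.isNilpotent_mul_right hg.2).neg
    · rw [inv_mul_eq_iff_eq_mul, ← mul_assoc, hgc k hk, mul_assoc, mul_inv_cancel, mul_one]

/-- `N(F)_ℤ = N(F) ∩ Γ`. -/
def arithStabilizer (L : HermitianLattice D n) (Γ : Subgroup (GL (Fin (n + 1)) ℂ))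
    (e : Fin (n + 1) → ℂ) : Subgroup (GL (Fin (n + 1)) ℂ) :=
  lineStabilizer L e ⊓ Γ

/-- `U(F)_ℤ = U(F) ∩ Γ`, as a subgroup of `N(F)_ℤ`. -/
def arithCenter (L : HermitianLattice D n) (Γ : Subgroup (GL (Fin (n + 1)) ℂ))
    (e : Fin (n + 1) → ℂ) : Subgroup (arithStabilizer L Γ e) :=
  (centerUnipotent L e ⊓ Γ).subgroupOf (arithStabilizer L Γ e)

instance arithCenter_normal (L : HermitianLattice D n) (Γ : Subgroup (GL (Fin (n + 1)) ℂ))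
    (e : Fin (n + 1) → ℂ) : (arithCenter L Γ e).Normal := by
  refine ⟨?_⟩
  rintro ⟨u, huN⟩ hu ⟨g, hgN⟩
  rw [arithCenter, Subgroup.mem_subgroupOf] at hu ⊢
  refine ⟨⟨conj_mem_unipotentRadical hgN.1 hu.1.1, fun k hk => ?_⟩,
    Γ.mul_mem (Γ.mul_mem hgN.2 hu.2) (Γ.inv_mem hgN.2)⟩
  have hk' := conj_mem_unipotentRadical (inv_mem hgN.1) hk
  have hc := hu.1.2 _ hk'
  have hc' : u * (g⁻¹ * k * g) = g⁻¹ * k * g * u := by simpa using hc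
  change g * u * g⁻¹ * k = k * (g * u * g⁻¹)
  calc g * u * g⁻¹ * k = g * (u * (g⁻¹ * k * g)) * g⁻¹ := by group
    _ = g * (g⁻¹ * k * g * u) * g⁻¹ := by rw [hc']
    _ = k * (g * u * g⁻¹) := by group

/-- `G(F) = N(F)_ℤ / U(F)_ℤ`. -/
abbrev CuspGroup (L : HermitianLattice D n) (Γ : Subgroup (GL (Fin (n + 1)) ℂ))
    (e : Fin (n + 1) → ℂ) : Type :=
  arithStabilizer L Γ e ⧸ arithCenter L Γ e

end Line

/-! ### Coordinates at a cusp.  From here on `n = m + 1`; the coordinate indices are `0`, the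
middle ones `mid i` for `i : Fin m`, and `Fin.last (m + 1)`. -/

/-- The middle indices. -/
def mid {m : ℕ} (i : Fin m) : Fin (m + 2) := i.succ.castSucc

/-- The Gram matrix of `h` with respect to the columns of `P`. -/
def gramMatrix {D : ℤ} {m : ℕ} (L : HermitianLattice D (m + 1))
    (P : GL (Fin (m + 2)) (quadField D)) : Matrix (Fin (m + 2)) (Fin (m + 2)) ℂ :=
  (P.1.map (algebraMap (quadField D) ℂ))ᴴ * L.formC * P.1.map (algebraMap (quadField D) ℂ)

/-- A basis `b₁, …, b_(n+1)` of `Λ ⊗ ℚ(√D)` (the columns of `P`) in which the Gram matrix has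
the block form with rows `(0, 0, a)`, `(0, B, 0)`, `(ā, 0, 0)`. The entries below the diagonal are
determined by hermitian symmetry. The first basis vector spans the isotropic line
defining the cusp. -/
structure CuspBasis {D : ℤ} {m : ℕ} (L : HermitianLattice D (m + 1)) where
  P : GL (Fin (m + 2)) (quadField D)
  gram_zero_zero : gramMatrix L P 0 0 = 0
  gram_zero_mid : ∀ i, gramMatrix L P 0 (mid i) = 0
  gram_mid_last : ∀ i, gramMatrix L P (mid i) (Fin.last (m + 1)) = 0
  gram_last_last : gramMatrix L P (Fin.last (m + 1)) (Fin.last (m + 1)) = 0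

namespace CuspBasis

variable {D : ℤ} {m : ℕ} {L : HermitianLattice D (m + 1)}

/-- The basis matrix, over `ℂ`. -/
def PC (b : CuspBasis L) : GL (Fin (m + 2)) ℂ :=
  Matrix.GeneralLinearGroup.map (algebraMap (quadField D) ℂ) b.P

/-- The Gram matrix of the basis. -/
def gram (b : CuspBasis L) : Matrix (Fin (m + 2)) (Fin (m + 2)) ℂ := gramMatrix L b.P

/-- The upper right entry `a` of the Gram matrix. -/
def a (b : CuspBasis L) : ℂ := b.gram 0 (Fin.last (m + 1))

/-- The first basis vector, a generator of the isotropic line. -/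
def e (b : CuspBasis L) : Fin (m + 2) → ℂ := fun i => b.PC.1 i 0

/-- The matrix of `g` with respect to the basis `b`. -/
def mat (b : CuspBasis L) (g : GL (Fin (m + 2)) ℂ) : Matrix (Fin (m + 2)) (Fin (m + 2)) ℂ :=
  (b.PC⁻¹ * g * b.PC : GL (Fin (m + 2)) ℂ).1

/-- The coordinate vector `(α, w, 1)`. -/
def homog (p : ℂ × (Fin m → ℂ)) : Fin (m + 2) → ℂ :=
  Fin.snoc (Fin.cons p.1 p.2 : Fin (m + 1) → ℂ) 1

/-- Complex hyperbolic space in the affine coordinates `(α, w) = (t₁, …, t_n)`, `t_(n+1) = 1`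
given by the basis `b`: the points at which `h` is negative. -/
def domain (b : CuspBasis L) : Set (ℂ × (Fin m → ℂ)) :=
  {p | (star (homog p) ⬝ᵥ b.gram *ᵥ homog p).re < 0}

/-- The projective action of `g` in the affine coordinates. -/
def affineAction (b : CuspBasis L) (g : GL (Fin (m + 2)) ℂ) (p : ℂ × (Fin m → ℂ)) :
    ℂ × (Fin m → ℂ) :=
  ((b.mat g *ᵥ homog p) 0 / (b.mat g *ᵥ homog p) (Fin.last (m + 1)),
    fun i => (b.mat g *ᵥ homog p) (mid i) / (b.mat g *ᵥ homog p) (Fin.last (m + 1)))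

/-- The elements of `U(F)` act by `α ↦ α + i a x` with `x` real; `period` is the smallest positive
`x` that occurs in `U(F)_ℤ`. -/
def period (b : CuspBasis L) (Γ : Subgroup (GL (Fin (m + 2)) ℂ)) : ℝ :=
  sInf {x : ℝ | 0 < x ∧ ∃ g ∈ centerUnipotent L b.e ⊓ Γ,
    b.mat g 0 (Fin.last (m + 1)) = Complex.I * b.a * (x : ℂ)}

/-- The translation `σ` generating the action of `U(F)_ℤ` on the coordinate `α`. -/
def sigma (b : CuspBasis L) (Γ : Subgroup (GL (Fin (m + 2)) ℂ)) : ℂ :=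
  Complex.I * b.a * (b.period Γ : ℂ)

/-- The torus coordinate `θ = exp_a(α) = exp(2πiα/σ)`. -/
def expA (b : CuspBasis L) (Γ : Subgroup (GL (Fin (m + 2)) ℂ)) (α : ℂ) : ℂ :=
  Complex.exp (2 * Real.pi * Complex.I / b.sigma Γ * α)

/-- The quotient map by `U(F)_ℤ`, `(α, w) ↦ (θ, w)`, with values in `ℂ × ℂ^(n-1)`. -/
def toTorus (b : CuspBasis L) (Γ : Subgroup (GL (Fin (m + 2)) ℂ)) (p : ℂ × (Fin m → ℂ)) :
    ℂ × (Fin m → ℂ) :=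
  (b.expA Γ p.1, p.2)

/-- The partial compactification of the quotient by `U(F)_ℤ`: its image in `ℂ × ℂ^(n-1)` together
with the boundary `{0} × ℂ^(n-1)`. -/
def partialCompactification (b : CuspBasis L) (Γ : Subgroup (GL (Fin (m + 2)) ℂ)) :
    Set (ℂ × (Fin m → ℂ)) :=
  b.toTorus Γ '' b.domain ∪ {p | p.1 = 0}

/-- The action of `g ∈ N(F)_ℤ`, with matrix of rows `(u, v, w)`, `(0, X, y)`, `(0, 0, z)`, on the
partial compactification: the holomorphic extension
`(θ, w') ↦ (θ · exp_a((v w' + w)/z), (X w' + y)/z)` of the projective action to `θ = 0`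
(see `toTorus_affineAction`). -/
def toroidalAction (b : CuspBasis L) (Γ : Subgroup (GL (Fin (m + 2)) ℂ))
    (g : GL (Fin (m + 2)) ℂ) (p : ℂ × (Fin m → ℂ)) : ℂ × (Fin m → ℂ) :=
  (p.1 * b.expA Γ ((∑ j, b.mat g 0 (mid j) * p.2 j + b.mat g 0 (Fin.last (m + 1))) /
      b.mat g (Fin.last (m + 1)) (Fin.last (m + 1))),
    fun i => (∑ j, b.mat g (mid i) (mid j) * p.2 j + b.mat g (mid i) (Fin.last (m + 1))) /
      b.mat g (Fin.last (m + 1)) (Fin.last (m + 1)))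

/-- The differential at the boundary point `(0, w₀)` of the action of `g`, an endomorphism of the
tangent space `ℂ × ℂ^(n-1)` when `g` fixes that point. -/
def tangentAction (b : CuspBasis L) (Γ : Subgroup (GL (Fin (m + 2)) ℂ))
    (g : GL (Fin (m + 2)) ℂ) (w₀ : Fin m → ℂ) : Module.End ℂ (ℂ × (Fin m → ℂ)) :=
  (fderiv ℂ (b.toroidalAction Γ g) (0, w₀)).toLinearMap

end CuspBasis

/-! ### Quasi-reflections and the Reid-Tai sum -/

/-- A quasi-reflection: an automorphism of finite order whose fixed space is a hyperplane, i.e.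
exactly one eigenvalue (with multiplicity) differs from `1`. -/
def IsQuasiReflection {V : Type*} [AddCommGroup V] [Module ℂ V] (A : Module.End ℂ V) : Prop :=
  IsOfFinOrder A ∧ Module.finrank ℂ (LinearMap.range (A - 1)) = 1

/-- The Reid-Tai sum `∑ aᵢ / l` with respect to a primitive `l`-th root of unity `ζ`, where the
eigenvalues (with multiplicity) are `ζ ^ aᵢ` with `0 ≤ aᵢ < l`; the least exponent is used. -/
def reidTaiSum {V : Type*} [AddCommGroup V] [Module ℂ V] [Module.Free ℂ V] [Module.Finite ℂ V]
    (l : ℕ) (ζ : ℂ) (A : Module.End ℂ V) : ℝ :=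
  (A.charpoly.roots.map fun μ => ((sInf {k : ℕ | ζ ^ k = μ} : ℕ) : ℝ) / (l : ℝ)).sum

end

end BallQuotient

/-! ### The coordinate formula extends the projective action -/

namespace BallQuotient
namespace CuspBasis
variable {D : ℤ} {m : ℕ} {L : HermitianLattice D (m + 1)}

theorem index_cases {C : Fin (m + 2) → Prop} (h0 : C 0) (hm : ∀ i, C (mid i))
    (hl : C (Fin.last (m + 1))) (i : Fin (m + 2)) : C i := by
  induction i using Fin.lastCases with
  | last => exact hl
  | cast j =>
    induction j using Fin.cases with
    | zero => exact h0
    | succ k => exact hm k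

theorem sum_index (f : Fin (m + 2) → ℂ) :
    ∑ i, f i = f 0 + ∑ i, f (mid i) + f (Fin.last (m + 1)) := by
  rw [Fin.sum_univ_castSucc, Fin.sum_univ_succ]; rfl

theorem homog_zero (p : ℂ × (Fin m → ℂ)) : homog p 0 = p.1 := by
  have : (0 : Fin (m + 2)) = Fin.castSucc 0 := rfl
  rw [homog, this, Fin.snoc_castSucc, Fin.cons_zero]

theorem homog_mid (p : ℂ × (Fin m → ℂ)) (i : Fin m) : homog p (mid i) = p.2 i := by
  rw [homog, mid, Fin.snoc_castSucc, Fin.cons_succ]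

theorem homog_last (p : ℂ × (Fin m → ℂ)) : homog p (Fin.last (m + 1)) = 1 := by
  rw [homog, Fin.snoc_last]

theorem mat_mulVec_single (b : CuspBasis L) {g : GL (Fin (m + 2)) ℂ} {c : ℂ}
    (hc : g.1 *ᵥ b.e = c • b.e) (i : Fin (m + 2)) : b.mat g i 0 = if i = 0 then c else 0 := by
  have he : b.e = b.PC.1 *ᵥ Pi.single 0 1 := by
    ext i; simp [e]
  have h1 : b.mat g *ᵥ Pi.single 0 1 = c • Pi.single 0 1 := by
    rw [mat, Units.val_mul, Units.val_mul, ← Matrix.mulVec_mulVec, ← he, ← Matrix.mulVec_mulVec,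
      hc, Matrix.mulVec_smul, he, Matrix.mulVec_mulVec, ← Units.val_mul, inv_mul_cancel,
      Units.val_one, Matrix.one_mulVec]
  have h2 := congrFun h1 i
  simp only [Matrix.mulVec_single_one, Matrix.col_apply, Pi.smul_apply, smul_eq_mul,
    Pi.single_apply] at h2
  rw [h2]; split_ifs <;> simp

theorem mat_unitary (b : CuspBasis L) {g : GL (Fin (m + 2)) ℂ} (hg : g ∈ L.realUnitary) :
    (b.mat g)ᴴ * b.gram * b.mat g = b.gram := by
  have hg' : g.1ᴴ * L.formC * g.1 = L.formC := hg
  have hG : b.gram = b.PC.1ᴴ * L.formC * b.PC.1 := rfl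
  have hPM : b.PC.1 * b.mat g = g.1 * b.PC.1 := by
    rw [mat, ← Units.val_mul, ← Units.val_mul]; congr 1; group
  calc (b.mat g)ᴴ * b.gram * b.mat g
      = (b.PC.1 * b.mat g)ᴴ * L.formC * (b.PC.1 * b.mat g) := by
        rw [hG, Matrix.conjTranspose_mul]; simp only [Matrix.mul_assoc]
    _ = b.PC.1ᴴ * (g.1ᴴ * L.formC * g.1) * b.PC.1 := by
        rw [hPM, Matrix.conjTranspose_mul]; simp only [Matrix.mul_assoc]
    _ = b.gram := by rw [hg', hG]

theorem formC_det_ne_zero (L : HermitianLattice D (m + 1)) : L.formC.det ≠ 0 := by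
  obtain ⟨T, hT⟩ := L.signature
  intro h
  have h1 := congrArg Matrix.det hT
  change (T.1ᴴ * L.formC * T.1).det = _ at h1
  rw [Matrix.det_mul, Matrix.det_mul, h, Matrix.det_diagonal] at h1
  simp [Fin.prod_univ_castSucc] at h1

theorem a_ne_zero (b : CuspBasis L) : b.a ≠ 0 := by
  intro ha
  have hG : b.gram = b.PC.1ᴴ * L.formC * b.PC.1 := rfl
  have hdet : b.gram.det = 0 := by
    refine Matrix.det_eq_zero_of_row_eq_zero 0 fun j => ?_
    exact index_cases (C := fun j => b.gram 0 j = 0) b.gram_zero_zero b.gram_zero_mid ha j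
  have hP : b.PC.1.det ≠ 0 := by
    have := b.PC.isUnit
    rw [Matrix.isUnit_iff_isUnit_det] at this
    exact this.ne_zero
  rw [hG, Matrix.det_mul, Matrix.det_mul, Matrix.det_conjTranspose] at hdet
  simp [hP, formC_det_ne_zero L] at hdet

/-- The first column of the matrix of an element of `N(F)` is `(u, 0, …, 0)`, the last row
is `(0, …, 0, z)`, and `ū z = 1`. -/
theorem mat_shape (b : CuspBasis L) {g : GL (Fin (m + 2)) ℂ}
    (hg : g ∈ lineStabilizer L b.e) :
    (∀ i, b.mat g (mid i) 0 = 0) ∧ b.mat g (Fin.last (m + 1)) 0 = 0 ∧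
      (∀ i, b.mat g (Fin.last (m + 1)) (mid i) = 0) ∧
      star (b.mat g 0 0) * b.mat g (Fin.last (m + 1)) (Fin.last (m + 1)) = 1 := by
  obtain ⟨hU, c, hc, hce⟩ := hg
  have hcol := b.mat_mulVec_single hce
  have hu := b.mat_unitary hU
  have key : ∀ j, star (b.mat g 0 0) * (b.a * b.mat g (Fin.last (m + 1)) j) = b.gram 0 j := by
    intro j
    have h := congrFun (congrFun hu 0) j
    rw [Matrix.mul_assoc, Matrix.mul_apply, sum_index] at h
    rw [← h]
    have e1 : ∀ i : Fin m, (b.mat g)ᴴ 0 (mid i) = 0 := fun i => by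
      rw [Matrix.conjTranspose_apply, hcol, if_neg (by simp [mid, Fin.ext_iff]), star_zero]
    have e2 : (b.mat g)ᴴ 0 (Fin.last (m + 1)) = 0 := by
      rw [Matrix.conjTranspose_apply, hcol, if_neg (by simp [Fin.ext_iff]), star_zero]
    have e3 : (b.gram * b.mat g) 0 j = b.a * b.mat g (Fin.last (m + 1)) j := by
      rw [Matrix.mul_apply, sum_index]
      have z0 : b.gram 0 0 = 0 := b.gram_zero_zero
      have zm : ∀ i, b.gram 0 (mid i) = 0 := b.gram_zero_mid
      simp [z0, zm, a]
    simp only [e1, e2, e3, zero_mul, Finset.sum_const_zero, add_zero, Matrix.conjTranspose_apply]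
  have h00 : b.mat g 0 0 = c := by rw [hcol, if_pos rfl]
  have ha := b.a_ne_zero
  refine ⟨fun i => ?_, ?_, fun i => ?_, ?_⟩
  · rw [hcol, if_neg (by simp [mid, Fin.ext_iff])]
  · rw [hcol, if_neg (by simp [Fin.ext_iff])]
  · have h := key (mid i)
    rw [show b.gram 0 (mid i) = 0 from b.gram_zero_mid i, h00] at h
    simpa [hc, ha] using h
  · have h := key (Fin.last (m + 1))
    change _ = b.a at h
    have : b.a * (star (b.mat g 0 0) * b.mat g (Fin.last (m + 1)) (Fin.last (m + 1))) =
        b.a * 1 := by rw [mul_one]; nth_rewrite 2 [← h]; ring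
    exact mul_left_cancel₀ ha this

theorem charpoly_mat (b : CuspBasis L) (g : GL (Fin (m + 2)) ℂ) :
    (b.mat g).charpoly = g.1.charpoly := by
  have h := Matrix.charpoly_units_conj' b.PC g.1
  rw [← h, mat, Units.val_mul, Units.val_mul, Matrix.coe_units_inv]

theorem isIntegral_of_isRoot {g : GL (Fin (m + 2)) ℂ} (hg : g ∈ L.unitaryGroup) {z : ℂ}
    (hz : g.1.charpoly.IsRoot z) : IsIntegral ℤ z := by
  obtain ⟨k, rfl⟩ := hg.2
  have h1 : IsIntegral (𝓞 (quadField D)) z := by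
    refine ⟨k.1.charpoly, Matrix.charpoly_monic _, ?_⟩
    have : ((Matrix.GeneralLinearGroup.map (algebraMap (𝓞 (quadField D)) ℂ) k :
      GL (Fin (m + 2)) ℂ) : Matrix (Fin (m + 2)) (Fin (m + 2)) ℂ) =
        k.1.map (algebraMap (𝓞 (quadField D)) ℂ) := rfl
    rw [this, Matrix.charpoly_map, Polynomial.IsRoot, Polynomial.eval_map] at hz
    exact hz
  exact isIntegral_trans (R := ℤ) (A := 𝓞 (quadField D)) z h1

theorem exists_rat_of_mem (hD : D < 0) {z : ℂ} (hz : z ∈ quadField D) :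
    ∃ q : ℚ, Complex.normSq z = (q : ℝ) := by
  suffices h : ∃ p q : ℚ, z = (p : ℂ) + q * (Complex.I * ((Real.sqrt (-(D : ℝ)) : ℝ) : ℂ)) by
    obtain ⟨p, q, rfl⟩ := h
    have hs : Real.sqrt (-(D : ℝ)) * Real.sqrt (-(D : ℝ)) = -D :=
      Real.mul_self_sqrt (by have : (D : ℝ) < 0 := by exact_mod_cast hD
                             linarith)
    refine ⟨p ^ 2 - q ^ 2 * D, ?_⟩
    have : Complex.normSq ((p : ℂ) + q * (Complex.I * ((Real.sqrt (-(D : ℝ)) : ℝ) : ℂ))) =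
        (p : ℝ) ^ 2 + (q : ℝ) ^ 2 * (Real.sqrt (-(D : ℝ)) * Real.sqrt (-(D : ℝ))) := by
      simp [Complex.normSq_apply]; ring
    rw [this, hs]; push_cast; ring
  have hδ : (Complex.I * ((Real.sqrt (-(D : ℝ)) : ℝ) : ℂ)) ^ 2 = (D : ℂ) := by
    have hs : Real.sqrt (-(D : ℝ)) ^ 2 = -D :=
      Real.sq_sqrt (by have : (D : ℝ) < 0 := by exact_mod_cast hD
                       linarith)
    rw [mul_pow, ← Complex.ofReal_pow, hs]; simp
  set δ : ℂ := Complex.I * ((Real.sqrt (-(D : ℝ)) : ℝ) : ℂ) with hδdef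
  refine IntermediateField.adjoin_induction ℚ
    (p := fun z _ => ∃ p q : ℚ, z = (p : ℂ) + q * δ) ?_ ?_ ?_ ?_ ?_ hz
  · rintro x rfl; exact ⟨0, 1, by simp [hδdef]⟩
  · intro x; exact ⟨x, 0, by simp⟩
  · rintro x y _ _ ⟨p, q, rfl⟩ ⟨r, s, rfl⟩
    exact ⟨p + r, q + s, by push_cast; ring⟩
  · rintro x _ ⟨p, q, rfl⟩
    by_cases h0 : (p : ℂ) + q * δ = 0
    · exact ⟨0, 0, by simp [h0]⟩
    · have hn : (p ^ 2 - q ^ 2 * D : ℚ) ≠ 0 := by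
        intro h
        have hD' : (D : ℚ) < 0 := by exact_mod_cast hD
        have hp : p = 0 := by nlinarith [sq_nonneg p, mul_nonneg (sq_nonneg q) (neg_nonneg.2 hD'.le)]
        have hq : q = 0 := by
          rw [hp] at h
          have : q ^ 2 * (D : ℚ) = 0 := by linarith
          simpa [hD'.ne] using this
        exact h0 (by simp [hp, hq])
      have hn' : ((p : ℂ) ^ 2 - q ^ 2 * D) ≠ 0 := by exact_mod_cast hn
      refine ⟨p / (p ^ 2 - q ^ 2 * D), -q / (p ^ 2 - q ^ 2 * D), ?_⟩
      rw [inv_eq_of_mul_eq_one_right]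
      push_cast
      field_simp
      linear_combination (-(q : ℂ) ^ 2) * hδ
  · rintro x y _ _ ⟨p, q, rfl⟩ ⟨r, s, rfl⟩
    exact ⟨p * r + q * s * D, p * s + q * r, by
      push_cast; linear_combination ((q : ℂ) * s) * hδ⟩

theorem mat_mem (b : CuspBasis L) {g : GL (Fin (m + 2)) ℂ} (hg : g ∈ L.unitaryGroup)
    (i j : Fin (m + 2)) : b.mat g i j ∈ quadField D := by
  obtain ⟨k, rfl⟩ := hg.2
  have h : b.mat (Matrix.GeneralLinearGroup.map (algebraMap (𝓞 (quadField D)) ℂ) k) =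
      (Matrix.GeneralLinearGroup.map (algebraMap (quadField D) ℂ) (b.P⁻¹ *
        Matrix.GeneralLinearGroup.map (algebraMap (𝓞 (quadField D)) (quadField D)) k *
        b.P)).1 := by
    rw [map_mul, map_mul, map_inv]
    rfl
  rw [h]
  exact SetLike.coe_mem (_ : quadField D)

/-- For `g ∈ N(F)_ℤ` the diagonal entries `u` and `z` agree, as `z` is a unit of `𝒪`. -/
theorem mat_zero_zero_eq (hD : D < 0) (b : CuspBasis L) {g : GL (Fin (m + 2)) ℂ}
    (hg : g ∈ lineStabilizer L b.e) (hgL : g ∈ L.unitaryGroup) :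
    b.mat g 0 0 = b.mat g (Fin.last (m + 1)) (Fin.last (m + 1)) := by
  obtain ⟨hm0, hl0, hlm, huz⟩ := b.mat_shape hg
  set M := b.mat g with hM
  set u := M 0 0
  set z := M (Fin.last (m + 1)) (Fin.last (m + 1))
  have hu : IsIntegral ℤ u := by
    refine isIntegral_of_isRoot hgL ?_
    rw [← b.charpoly_mat, Polynomial.IsRoot, Matrix.eval_charpoly]
    refine Matrix.det_eq_zero_of_column_eq_zero 0 ?_
    refine index_cases ?_ (fun i => ?_) ?_
    · simp [u, hM]
    · have h1 : mid i ≠ 0 := by simp [mid, Fin.ext_iff]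
      simp [← hM, hm0, h1]
    · simp [← hM, hl0, Fin.ext_iff]
  have hz : IsIntegral ℤ z := by
    refine isIntegral_of_isRoot hgL ?_
    rw [← b.charpoly_mat, Polynomial.IsRoot, Matrix.eval_charpoly]
    refine Matrix.det_eq_zero_of_row_eq_zero (Fin.last (m + 1)) ?_
    refine index_cases ?_ (fun i => ?_) ?_
    · simp [← hM, hl0, Fin.ext_iff]
    · have h1 : Fin.last (m + 1) ≠ mid i := by
        have := i.2
        simp only [mid, ne_eq, Fin.ext_iff, Fin.val_last, Fin.val_castSucc, Fin.val_succ]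
        omega
      simp [← hM, hlm, h1]
    · simp [z, hM]
  have hint : ∀ x : ℂ, IsIntegral ℤ x → x ∈ quadField D → ∃ k : ℤ, Complex.normSq x = k := by
    intro x hx hxK
    obtain ⟨q, hq⟩ := exists_rat_of_mem hD hxK
    have hx' : IsIntegral ℤ (star x) := hx.map (starRingEnd ℂ).toIntAlgHom
    have h1 : IsIntegral ℤ ((q : ℚ) : ℂ) := by
      have : ((q : ℚ) : ℂ) = x * star x := by
        have := Complex.mul_conj x
        rw [hq] at this
        rw [Complex.star_def, this]; simp
      rw [this]; exact hx.mul hx'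
    have h2 : IsIntegral ℤ q := by
      have := (isIntegral_algebraMap_iff (A := ℚ) (B := ℂ) (R := ℤ) (x := q)
        (algebraMap ℚ ℂ).injective).1 (by simpa using h1)
      exact this
    obtain ⟨k, hk⟩ := IsIntegrallyClosed.isIntegral_iff.1 h2
    exact ⟨k, by rw [hq, ← hk]; simp⟩
  obtain ⟨k, hk⟩ := hint u hu (b.mat_mem hgL _ _)
  obtain ⟨l, hl⟩ := hint z hz (b.mat_mem hgL _ _)
  have hkl : Complex.normSq u * Complex.normSq z = 1 := by
    have := congrArg Complex.normSq huz
    rwa [map_mul, Complex.star_def, Complex.normSq_conj, map_one] at this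
  have hkl' : k * l = 1 := by rw [hk, hl] at hkl; exact_mod_cast hkl
  have hl0' : 0 ≤ k := by
    have := Complex.normSq_nonneg u
    rw [hk] at this; exact_mod_cast this
  have hk1 : k = 1 := Int.eq_one_of_mul_eq_one_right hl0' hkl'
  have huu : u * star u = 1 := by
    rw [Complex.star_def, Complex.mul_conj, hk, hk1]; simp
  calc u = u * (star u * z) := by rw [huz, mul_one]
    _ = z := by rw [← mul_assoc, huu, one_mul]

/-- `toroidalAction` extends the action on complex hyperbolic space modulo `U(F)_ℤ`. -/
theorem toTorus_affineAction (hD : D < 0) (b : CuspBasis L)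
    {Γ : Subgroup (GL (Fin (m + 2)) ℂ)} (hΓ : Γ ≤ L.unitaryGroup) {g : GL (Fin (m + 2)) ℂ}
    (hg : g ∈ arithStabilizer L Γ b.e) (p : ℂ × (Fin m → ℂ)) :
    b.toTorus Γ (b.affineAction g p) = b.toroidalAction Γ g (b.toTorus Γ p) := by
  obtain ⟨hm0, hl0, hlm, huz⟩ := b.mat_shape hg.1
  have hz : b.mat g (Fin.last (m + 1)) (Fin.last (m + 1)) ≠ 0 := right_ne_zero_of_mul_eq_one huz
  have h0 := b.mat_zero_zero_eq hD hg.1 (hΓ hg.2)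
  have hlast : (b.mat g *ᵥ homog p) (Fin.last (m + 1)) =
      b.mat g (Fin.last (m + 1)) (Fin.last (m + 1)) := by
    rw [Matrix.mulVec, dotProduct, sum_index]
    simp [hl0, hlm, homog_last]
  have hmid : ∀ i, (b.mat g *ᵥ homog p) (mid i) =
      ∑ j, b.mat g (mid i) (mid j) * p.2 j + b.mat g (mid i) (Fin.last (m + 1)) := by
    intro i
    rw [Matrix.mulVec, dotProduct, sum_index]
    simp [hm0, homog_last, homog_mid]
  have hzero : (b.mat g *ᵥ homog p) 0 = b.mat g 0 0 * p.1 +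
      (∑ j, b.mat g 0 (mid j) * p.2 j + b.mat g 0 (Fin.last (m + 1))) := by
    rw [Matrix.mulVec, dotProduct, sum_index]
    simp [homog_last, homog_mid, homog_zero, add_assoc]
  refine Prod.ext ?_ ?_
  · simp only [toTorus, affineAction, toroidalAction, expA]
    rw [← Complex.exp_add, hzero, hlast, h0, add_div, mul_div_cancel_left₀ _ hz, mul_add]
  · funext i
    simp only [toTorus, affineAction, toroidalAction]
    rw [hmid, hlast]

end CuspBasis
end BallQuotient

namespace BallQuotient

open Polynomial

/-! ### Arithmetic of `ℚ(√D)`: units, and Kronecker's theorem over it -/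

section Arithmetic

variable {D : ℤ}

/-! Write `g` in the cusp basis with diagonal blocks `u`, `X`, `z`. The entry `z` is an algebraic
integer of absolute value one in `K = ℚ(√D)`, and `D < -3` leaves only `u = z = ±1`. At `(0, w₀)`
the differential is therefore block diagonal (`tangentAction_eq`, `blockEnd`): a scalar `t =
exp_a(twist)` on `θ`, and the matrix `R = X / z` on the boundary.

Finite order. The middle Gram block `B` is positive definite (`midGram_definite`) and `R` is an
isometry of it, so its eigenvalues have absolute value one. They are algebraic integers, and each
conjugate over `ℚ` is an eigenvalue of `R` or the complex conjugate of one; by Kronecker they are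
roots of unity, and definiteness makes `R` itself of finite order. A suitable power of `g` then has
`X = 1`, `z = 1`, and since it fixes `w₀` it is a translation of `α` lying in `U(F)_ℤ`
(`exists_pow_eq_translation`). The same power shows that `t` is a root of unity.

The inequality. Suppose `R` has an eigenvalue of order `d ≥ 3`. Its conjugates over `K` are also
eigenvalues; let `S` be the set of their exponents modulo `d`. For every unit `b` modulo `d`, `S`
contains `b` or `d - b`. The product of the conjugates is a root of unity in `K`, hence `±1`, so `d`
divides `2 ∑ S`. If `∑ S < d` then `2 ∑ S = d`, which is possible only for `d = 8`, `S = {1, 3}` and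
`d = 12`, `S = {1, 5}` (`eq_of_two_mul_sum_eq`). In these cases the sum of the conjugates is an
element of `K` with square `-2` or `-1`, contradicting `D < -3`. So these conjugates alone
contribute at least `1` (`one_le_sum_aroots_minpoly`).

Otherwise `R` has only the eigenvalues `±1`. Two eigenvalues `-1` give `1/2 + 1/2`. With exactly
one, `t² ≠ 1` makes the square of the differential a quasi-reflection, `t = 1` makes the
differential one, and `t = -1` supplies the second `1/2`. If `R = 1`, the differential is a
quasi-reflection unless `t = 1`, and then the action is trivial. -/

theorem sqrtD_mem_quadField (D : ℤ) :
    Complex.I * ((Real.sqrt (-(D : ℝ)) : ℝ) : ℂ) ∈ quadField D :=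
  IntermediateField.subset_adjoin ℚ _ rfl

/-- The norms of `z` and `z + 1` are rational and differ by `2 Re z + 1`. -/
theorem re_rational_of_mem (hD : D < 0) {z : ℂ} (hz : z ∈ quadField D) :
    ∃ p : ℚ, z.re = (p : ℝ) := by
  obtain ⟨q, hq⟩ := CuspBasis.exists_rat_of_mem hD hz
  obtain ⟨r, hr⟩ := CuspBasis.exists_rat_of_mem hD (add_mem hz (one_mem (quadField D)))
  refine ⟨(r - q - 1) / 2, ?_⟩
  rw [Complex.normSq_apply] at hq hr
  simp only [Complex.add_re, Complex.one_re, Complex.add_im, Complex.one_im, add_zero] at hr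
  push_cast
  rw [← hq, ← hr]; ring

/-- Multiplication by `√D` turns the imaginary part into a real part. -/
theorem im_of_mem (hD : D < 0) {z : ℂ} (hz : z ∈ quadField D) :
    ∃ q : ℚ, z.im = (q : ℝ) * Real.sqrt (-(D : ℝ)) := by
  obtain ⟨r, hr⟩ := re_rational_of_mem hD (mul_mem hz (sqrtD_mem_quadField D))
  have hD' : (D : ℝ) < 0 := by exact_mod_cast hD
  have hs : Real.sqrt (-(D : ℝ)) * Real.sqrt (-(D : ℝ)) = -D :=
    Real.mul_self_sqrt (by linarith)
  refine ⟨r / D, ?_⟩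
  simp [Complex.mul_re] at hr
  push_cast
  rw [← hr, div_mul_eq_mul_div, eq_div_iff hD'.ne]
  linear_combination z.im * hs

theorem star_mem_quadField (hD : D < 0) {z : ℂ} (hz : z ∈ quadField D) :
    star z ∈ quadField D := by
  obtain ⟨p, hp⟩ := re_rational_of_mem hD hz
  have h : star z = algebraMap ℚ ℂ (2 * p) - z := by
    apply Complex.ext
    · simp [hp]; ring
    · simp
  rw [h]
  exact sub_mem (IntermediateField.algebraMap_mem _ _) hz

theorem exists_rat_of_mem_of_im_eq_zero (hD : D < 0) {z : ℂ} (hz : z ∈ quadField D)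
    (him : z.im = 0) : ∃ p : ℚ, z = algebraMap ℚ ℂ p := by
  obtain ⟨p, hp⟩ := re_rational_of_mem hD hz
  exact ⟨p, Complex.ext (by simp [hp]) (by simp [him])⟩

/-- A squarefree integer of absolute value exceeding `3` is not `1`, `2` or `3` times the square
of a rational number. -/
theorem sq_mul_neg_ne (hsq : Squarefree D) (hD : D < -3) (q : ℚ) {c : ℤ} (hc0 : 0 < c)
    (hc : c ≤ 3) : q ^ 2 * (-(D : ℚ)) ≠ c := by
  intro h
  have hden : (q.den : ℚ) ≠ 0 := by exact_mod_cast q.den_nz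
  have h1 : q.num ^ 2 * (-D) = c * (q.den : ℤ) ^ 2 := by
    have : (q.num : ℚ) ^ 2 * (-D) = c * (q.den : ℚ) ^ 2 := by
      have hq : (q.num : ℚ) = q * q.den := (Rat.mul_den_eq_num q).symm
      rw [hq, ← h]; ring
    exact_mod_cast this
  have hcop : IsCoprime ((q.den : ℤ) ^ 2) (q.num ^ 2) := by
    refine IsCoprime.pow ?_
    rw [Int.isCoprime_iff_gcd_eq_one]
    have := q.reduced
    rw [Nat.Coprime, Nat.gcd_comm] at this
    simpa [Int.gcd] using this
  -- The squared denominator is prime to the squared numerator, so it divides `D`; squarefreeness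
  -- makes `q` an integer, and `q² |D| ≤ 3 < |D|` is absurd.
  have h2 : (q.den : ℤ) ^ 2 ∣ D := by
    have : (q.den : ℤ) ^ 2 ∣ q.num ^ 2 * (-D) := ⟨c, by rw [h1]; ring⟩
    exact (dvd_neg.1 (hcop.dvd_of_dvd_mul_left this))
  have h3 : IsUnit (q.den : ℤ) := hsq _ (by rw [← sq]; exact h2)
  have h4 : (q.den : ℤ) ^ 2 = 1 := by
    rcases Int.isUnit_iff.1 h3 with h | h <;> rw [h] <;> norm_num
  rw [h4, mul_one] at h1
  have h5 : q.num ≠ 0 := by rintro h0; rw [h0] at h1; omega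
  have h6 : 1 ≤ q.num ^ 2 := by have := sq_pos_of_ne_zero h5; omega
  nlinarith

/-- The only algebraic integers of absolute value one in `ℚ(√D)` are `1` and `-1`. -/
theorem eq_one_or_neg_one_of_isIntegral (hsq : Squarefree D) (hD : D < -3) {z : ℂ}
    (hz : z ∈ quadField D) (hint : IsIntegral ℤ z) (hn : Complex.normSq z = 1) :
    z = 1 ∨ z = -1 := by
  have hD0 : D < 0 := by omega
  obtain ⟨p, hp⟩ := re_rational_of_mem hD0 hz
  obtain ⟨q, hq⟩ := im_of_mem hD0 hz
  have hs : Real.sqrt (-(D : ℝ)) * Real.sqrt (-(D : ℝ)) = -D :=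
    Real.mul_self_sqrt (by have : (D : ℝ) < 0 := by exact_mod_cast hD0
                           linarith)
  have hpq : p ^ 2 + q ^ 2 * (-(D : ℚ)) = 1 := by
    rw [Complex.normSq_apply, hp, hq] at hn
    have : (p : ℝ) ^ 2 + (q : ℝ) ^ 2 * (-D) = 1 := by rw [← hs, ← hn]; ring
    exact_mod_cast this
  -- The trace `k = z + star z` is an integer with `k² + (2q)² |D| = 4`. The values `k = ±2` give `z
  -- = ±1`; `k = ±1` would need `(2q)² |D| = 3` and `k = 0` would need `q² |D| = 1`.
  obtain ⟨k, hk⟩ : ∃ k : ℤ, 2 * p = k := by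
    have h1 : IsIntegral ℤ (algebraMap ℚ ℂ (2 * p)) := by
      have : algebraMap ℚ ℂ (2 * p) = z + star z := by
        apply Complex.ext
        · simp [hp]; ring
        · simp
      rw [this]
      exact hint.add (hint.map (starRingEnd ℂ).toIntAlgHom)
    have h2 := (isIntegral_algebraMap_iff (A := ℚ) (B := ℂ) (R := ℤ)
      (algebraMap ℚ ℂ).injective).1 h1
    obtain ⟨k, hk⟩ := IsIntegrallyClosed.isIntegral_iff.1 h2
    exact ⟨k, by rw [← hk]; simp⟩
  have hD' : (D : ℚ) < 0 := by exact_mod_cast hD0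
  have hk4 : (k : ℚ) ^ 2 + (2 * q) ^ 2 * (-(D : ℚ)) = 4 := by
    rw [← hk]; linear_combination 4 * hpq
  have hkle : k ^ 2 ≤ 4 := by
    have : (k : ℚ) ^ 2 ≤ 4 := by nlinarith [mul_nonneg (sq_nonneg (2 * q)) (neg_nonneg.2 hD'.le)]
    exact_mod_cast this
  have hk2 : k ≤ 2 := by nlinarith
  have hk2' : -2 ≤ k := by nlinarith
  have hfin : (p = 1 ∨ p = -1) → z = 1 ∨ z = -1 := by
    intro h
    have hq0 : q = 0 := by
      have hp2 : p ^ 2 = 1 := by rcases h with h | h <;> rw [h] <;> norm_num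
      rw [hp2] at hpq
      have : q ^ 2 * (-(D : ℚ)) = 0 := by linarith
      simpa [hD'.ne] using this
    rcases h with h | h
    · left; apply Complex.ext <;> simp [hp, hq, h, hq0]
    · right; apply Complex.ext <;> simp [hp, hq, h, hq0]
  interval_cases k
  · exact hfin (Or.inr (by push_cast at hk; linarith))
  · exact absurd (by push_cast at hk4 ⊢; linarith) (sq_mul_neg_ne hsq hD (2 * q) (c := 3)
      (by norm_num) (by norm_num))
  · exact absurd (by push_cast at hk hk4 ⊢; linarith) (sq_mul_neg_ne hsq hD q (c := 1)
      (by norm_num) (by norm_num))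
  · exact absurd (by push_cast at hk4 ⊢; linarith) (sq_mul_neg_ne hsq hD (2 * q) (c := 3)
      (by norm_num) (by norm_num))
  · exact hfin (Or.inl (by push_cast at hk; linarith))

theorem eq_one_or_neg_one_of_pow_eq_one (hsq : Squarefree D) (hD : D < -3) {z : ℂ}
    (hz : z ∈ quadField D) {N : ℕ} (hN : 0 < N) (h : z ^ N = 1) : z = 1 ∨ z = -1 := by
  refine eq_one_or_neg_one_of_isIntegral hsq hD hz ?_ ?_
  · refine ⟨X ^ N - C 1, monic_X_pow_sub_C _ hN.ne', by simp [h]⟩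
  · rw [Complex.normSq_eq_norm_sq, Complex.norm_eq_one_of_pow_eq_one h hN.ne']; norm_num

/-- A square root of `-2` is purely imaginary, `z = q √D` with `q² |D| = 2`. This rules out the
exceptional case of order `8`. -/
theorem sq_ne_neg_two_of_mem (hsq : Squarefree D) (hD : D < -3) {z : ℂ}
    (hz : z ∈ quadField D) : z ^ 2 ≠ -2 := by
  intro h
  have hD0 : D < 0 := by omega
  obtain ⟨p, hp⟩ := re_rational_of_mem hD0 hz
  obtain ⟨q, hq⟩ := im_of_mem hD0 hz
  have hs : Real.sqrt (-(D : ℝ)) * Real.sqrt (-(D : ℝ)) = -D :=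
    Real.mul_self_sqrt (by have : (D : ℝ) < 0 := by exact_mod_cast hD0
                           linarith)
  have hre := congrArg Complex.re h
  have him := congrArg Complex.im h
  simp [sq, Complex.mul_re, Complex.mul_im] at hre him
  have hre0 : z.re = 0 := by
    rcases mul_self_eq_zero.1 (show z.re * z.im * (z.re * z.im) = 0 by
      rw [show z.re * z.im = 0 by linarith]; ring) |> mul_eq_zero.1 with h0 | h0
    · exact h0
    · rw [h0] at hre; nlinarith [mul_self_nonneg z.re]
  refine sq_mul_neg_ne hsq hD q (c := 2) (by norm_num) (by norm_num) ?_
  have : (q : ℝ) ^ 2 * (-D) = 2 := by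
    rw [hre0, hq] at hre
    rw [← hs]; linear_combination -hre
  exact_mod_cast this

/-- If `λ` is a root of a polynomial over `ℚ(√D)`, every conjugate of `λ` over `ℚ` or its complex
conjugate is a root as well. -/
theorem isRoot_or_isRoot_star (hD : D < 0) (p : (quadField D)[X]) {x y : ℂ}
    (hx : aeval x p = 0) (hy : aeval y (minpoly ℚ x) = 0) :
    aeval y p = 0 ∨ aeval (star y) p = 0 := by
  set P : ℂ[X] := p.map (algebraMap (quadField D) ℂ) with hP
  -- `Q` is invariant under complex conjugation, so its coefficients lie in `K ∩ ℝ = ℚ`; every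
  -- conjugate of `x` over `ℚ` is then a root of `P` or of its complex conjugate.
  set Q : ℂ[X] := P * P.map (starRingEnd ℂ) with hQ
  have hQstar : Q.map (starRingEnd ℂ) = Q := by
    have h1 : ∀ r : ℂ[X], (r.map (starRingEnd ℂ)).map (starRingEnd ℂ) = r := fun r => by
      ext n; simp
    rw [hQ, Polynomial.map_mul, h1, mul_comm]
  have hPmem : ∀ n, P.coeff n ∈ quadField D := fun n => by
    rw [hP, coeff_map]; exact SetLike.coe_mem (p.coeff n)
  have hQmem : ∀ n, Q.coeff n ∈ quadField D := fun n => by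
    rw [hQ, coeff_mul]
    refine sum_mem fun i _ => mul_mem (hPmem _) ?_
    rw [coeff_map]; exact star_mem_quadField hD (hPmem _)
  have hrat : ∀ n, ∃ r : ℚ, Q.coeff n = algebraMap ℚ ℂ r := fun n => by
    refine exists_rat_of_mem_of_im_eq_zero hD (hQmem n) ?_
    have := congrArg (fun q => Polynomial.coeff q n) hQstar
    simp only [coeff_map] at this
    exact Complex.conj_eq_iff_im.1 this
  obtain ⟨q, hq⟩ : ∃ q : ℚ[X], q.map (algebraMap ℚ ℂ) = Q := by
    have := (Polynomial.mem_lifts (f := algebraMap ℚ ℂ) Q).1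
      ((Polynomial.lifts_iff_coeff_lifts Q).2 fun n => by
        obtain ⟨r, hr⟩ := hrat n
        exact ⟨r, hr.symm⟩)
    exact this
  have hqx : aeval x q = 0 := by
    rw [← eval_map_algebraMap, hq, hQ, eval_mul, hP, eval_map_algebraMap, hx, zero_mul]
  have hqy : aeval y q = 0 := by
    obtain ⟨r, hr⟩ := minpoly.dvd ℚ x hqx
    rw [hr, map_mul, hy, zero_mul]
  rw [← eval_map_algebraMap, hq, hQ, eval_mul, mul_eq_zero] at hqy
  rcases hqy with h | h
  · left; rwa [hP, eval_map_algebraMap] at h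
  · right
    have h2 : (starRingEnd ℂ) (eval (star y) P) = 0 := by
      rw [← h, ← Polynomial.eval_map_apply]; simp
    rw [← eval_map_algebraMap, ← hP]
    simpa using h2

/-- Kronecker's theorem, transported from the number field `ℚ(x)` to the complex number `x`. -/
theorem exists_pow_eq_one_of_norm_conjugates {x : ℂ} (hx : IsIntegral ℤ x)
    (h : ∀ y : ℂ, aeval y (minpoly ℚ x) = 0 → ‖y‖ = 1) : ∃ n : ℕ, 0 < n ∧ x ^ n = 1 := by
  have hxQ : IsIntegral ℚ x := hx.tower_top
  let K := IntermediateField.adjoin ℚ {x}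
  have : FiniteDimensional ℚ K := IntermediateField.adjoin.finiteDimensional hxQ
  have : NumberField K := { to_charZero := inferInstance, to_finiteDimensional := inferInstance }
  let y : K := ⟨x, IntermediateField.mem_adjoin_simple_self ℚ x⟩
  have hyint : IsIntegral ℤ y := by
    refine (isIntegral_algebraMap_iff (A := K) (B := ℂ) (R := ℤ) (algebraMap K ℂ).injective).1 ?_
    exact hx
  obtain ⟨n, hn, hyn⟩ := NumberField.Embeddings.pow_eq_one_of_norm_eq_one K ℂ hyint fun φ => by
    refine h _ ?_
    have h1 : minpoly ℚ x = minpoly ℚ y :=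
      minpoly.algebraMap_eq (B := K) (B' := ℂ) (algebraMap K ℂ).injective y
    have h2 := congrArg φ (minpoly.aeval ℚ y)
    rw [map_zero] at h2
    rw [h1, ← h2]
    exact aeval_algHom_apply (RingHom.toRatAlgHom φ) y _
  exact ⟨n, hn, congrArg (algebraMap K ℂ) hyn⟩

/-- A form of Kronecker's theorem over `K`: a conjugate over `ℚ` need not be a root of `p`, but then
its complex conjugate, of the same absolute value, is. -/
theorem exists_pow_eq_one_of_roots (hD : D < 0) (p : (quadField D)[X])
    (h : ∀ y : ℂ, aeval y p = 0 → ‖y‖ = 1) {x : ℂ} (hx : IsIntegral ℤ x) (hxp : aeval x p = 0) :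
    ∃ n : ℕ, 0 < n ∧ x ^ n = 1 := by
  refine exists_pow_eq_one_of_norm_conjugates hx fun y hy => ?_
  rcases isRoot_or_isRoot_star hD p hxp hy with h1 | h1
  · exact h y h1
  · rw [← h _ h1, norm_star]

end Arithmetic

/-! ### Half-systems of units modulo `d` with small sum -/

section Combinatorics

/-- A set of residues containing one of `b`, `-b` for each unit `b` modulo `d`, whose sum is half
of `d`, is one of two exceptional sets. -/
theorem eq_of_two_mul_sum_eq {d : ℕ} (hd : 3 ≤ d) {S : Finset ℕ} (hlt : ∀ b ∈ S, b < d)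
    (hcop : ∀ b ∈ S, b.Coprime d)
    (hS : ∀ b, b < d → b.Coprime d → b ∈ S ∨ d - b ∈ S) (hsum : 2 * ∑ b ∈ S, b = d) :
    (d = 8 ∧ S = {1, 3}) ∨ (d = 12 ∧ S = {1, 5}) := by
  set e := ∑ b ∈ S, b with he
  subst hsum
  -- With `d = 2e`, any few elements of `S` have sum at most `e = ∑ S`. So a unit `b` with `d - b >
  -- e` must itself lie in `S`; units just below `e` quickly exhaust this budget.
  have hle : ∀ T ⊆ S, ∑ b ∈ T, b ≤ e := fun T hT => Finset.sum_le_sum_of_subset hT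
  have h1' : ∀ a ∈ S, a ≤ e := fun a ha => by
    have := hle {a} (by simpa using ha)
    simpa using this
  have h2' : ∀ a ∈ S, ∀ b ∈ S, a ≠ b → a + b ≤ e := fun a ha b hb hab => by
    have := hle {a, b} (by intro x hx; simp at hx; rcases hx with rfl | rfl <;> assumption)
    rwa [Finset.sum_pair hab] at this
  have h3' : ∀ a ∈ S, ∀ b ∈ S, ∀ c ∈ S, a ≠ b → a ≠ c → b ≠ c → a + b + c ≤ e :=
    fun a ha b hb c hc hab hac hbc => by
    have := hle {a, b, c} (by
      intro x hx; simp at hx; rcases hx with rfl | rfl | rfl <;> assumption)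
    rw [Finset.sum_insert (by simp [hab, hac]), Finset.sum_pair hbc] at this
    omega
  have hcop2 : ∀ b ∈ S, b % 2 = 1 := fun b hb => by
    have h := (hcop b hb).coprime_dvd_right (Dvd.intro e rfl)
    exact Nat.odd_iff.1 (Nat.coprime_two_right.1 h)
  have hu1 : 1 ∈ S := by
    rcases hS 1 (by omega) (Nat.coprime_one_left _) with h | h
    · exact h
    · have := h1' _ h; have := hcop2 _ h; omega
  rcases Nat.even_or_odd' e with ⟨f, hf | hf⟩
  · -- `e` is even
    have hcope : (e - 1).Coprime (2 * e) := by
      refine Nat.Coprime.mul_right ?_ ?_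
      · rw [Nat.coprime_two_right, Nat.odd_iff]; omega
      · have : (e - 1).Coprime (e - 1 + 1) := by simp
        rwa [Nat.sub_add_cancel (by omega)] at this
    have hu2 : e - 1 ∈ S := by
      rcases hS (e - 1) (by omega) hcope with h | h
      · exact h
      · have := h1' _ h; omega
    have hf1 : f ≠ 1 := by
      rintro rfl
      have hS1 : S = {1} := by
        ext a
        simp only [Finset.mem_singleton]
        refine ⟨fun ha => ?_, fun ha => ha ▸ hu1⟩
        have := h1' a ha
        have := hcop2 a ha
        omega
      rw [hS1] at he
      simp at he
      omega
    -- The elements `1` and `e - 1` already use up the whole sum `e`.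
    have hSeq : S = {1, e - 1} := by
      ext a
      simp only [Finset.mem_insert, Finset.mem_singleton]
      refine ⟨fun ha => ?_, fun ha => by rcases ha with rfl | rfl <;> assumption⟩
      by_contra! hne
      have := h3' 1 hu1 (e - 1) hu2 a ha (by omega) (by omega) (by omega)
      have := hcop2 a ha
      omega
    have hno : ∀ b, 1 < b → b < e - 1 → ¬ b.Coprime (2 * e) := fun b hb hbe hc => by
      rcases hS b (by omega) hc with h | h
      · rw [hSeq] at h
        simp at h; omega
      · rw [hSeq] at h
        simp at h; omega
    have hcopf : ∀ b, b % 2 = 1 → b.Coprime f → b.Coprime (2 * e) := fun b hb hbf => by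
      rw [hf]
      have : b.Coprime 2 := by rw [Nat.coprime_two_right, Nat.odd_iff]; exact hb
      exact this.mul_right (this.mul_right hbf)
    by_cases hf2 : f = 2
    · left; subst hf2; rw [hSeq, hf]; simp
    by_cases hf3 : f = 3
    · right; subst hf3; rw [hSeq, hf]; simp
    exfalso
    -- For `f ≥ 4` there is a further unit modulo `4f` strictly between `1` and `e - 1`: `f - 1` if
    -- `f` is even, `f - 2` if `f` is odd.
    rcases Nat.even_or_odd' f with ⟨j, hj | hj⟩
    · refine hno (f - 1) (by omega) (by omega) (hcopf _ (by omega) ?_)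
      have : (f - 1).Coprime (f - 1 + 1) := by simp
      rwa [Nat.sub_add_cancel (by omega)] at this
    · refine hno (f - 2) (by omega) (by omega) (hcopf _ (by omega) ?_)
      have : (f - 2).Coprime (f - 2 + 2) := by
        rw [Nat.coprime_self_add_right, Nat.coprime_two_right, Nat.odd_iff]; omega
      rwa [Nat.sub_add_cancel (by omega)] at this
  · -- `e` is odd
    exfalso
    have hcopk : ∀ b k, b % 2 = 1 → k.Coprime b → b + k = e → b.Coprime (2 * e) :=
      fun b k hb hk hbk => by
        have h2 : b.Coprime 2 := by rw [Nat.coprime_two_right, Nat.odd_iff]; exact hb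
        refine h2.mul_right ?_
        rw [← hbk, Nat.coprime_self_add_right]
        exact hk.symm
    have hc2 : ∀ b, b % 2 = 1 → Nat.Coprime 2 b := fun b hb => by
      rw [Nat.coprime_two_left, Nat.odd_iff]; exact hb
    have hu2 : e - 2 ∈ S := by
      rcases hS (e - 2) (by omega)
        (hcopk _ 2 (by omega) (hc2 _ (by omega)) (by omega)) with h | h
      · exact h
      · have := h1' _ h; omega
    have he3 : e ≠ 3 := by
      intro he3
      have hS1 : S = {1} := by
        ext a
        simp only [Finset.mem_singleton]
        refine ⟨fun ha => ?_, fun ha => ha ▸ hu1⟩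
        by_contra hne
        have := h2' 1 hu1 a ha (Ne.symm hne)
        have := hcop2 a ha
        omega
      rw [hS1] at he
      simp at he
      omega
    have he5 : e ≠ 5 := by
      intro he5
      have hS1 : S = {1, 3} := by
        ext a
        simp only [Finset.mem_insert, Finset.mem_singleton]
        refine ⟨fun ha => ?_, fun ha => ?_⟩
        · by_contra! hne
          have := h2' 1 hu1 a ha hne.1.symm
          have := hcop2 a ha
          omega
        · rcases ha with rfl | rfl
          · exact hu1
          · rwa [he5] at hu2
      rw [hS1] at he
      simp at he
      omega
    have hu4 : e - 4 ∈ S := by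
      rcases hS (e - 4) (by omega)
        (hcopk _ 4 (by omega) ((hc2 _ (by omega)).pow_left 2) (by omega)) with h | h
      · exact h
      · have := h1' _ h; omega
    -- Now `e ≥ 7`, and `(e - 2) + (e - 4)` exceeds `e`.
    have := h2' _ hu2 _ hu4 (by omega)
    omega

end Combinatorics

/-! ### The contribution of a Galois orbit of roots of unity -/

section RootsOfUnity

theorem sInf_pow_eq {l : ℕ} {ζ : ℂ} (hζ : IsPrimitiveRoot ζ l) {k : ℕ} (hk : k < l) :
    sInf {j : ℕ | ζ ^ j = ζ ^ k} = k := by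
  have hmem : k ∈ {j : ℕ | ζ ^ j = ζ ^ k} := rfl
  have hle := Nat.sInf_le hmem
  exact hζ.pow_inj (hle.trans_lt hk) hk (Nat.sInf_mem ⟨k, hmem⟩)

theorem primitive_twelfth_sum {ξ : ℂ} (h : IsPrimitiveRoot ξ 12) : (ξ + ξ ^ 5) ^ 2 = -1 := by
  have h6 : ξ ^ 6 = -1 := by
    have h1 : ξ ^ 6 * ξ ^ 6 = 1 := by rw [← pow_add]; exact h.pow_eq_one
    rcases mul_self_eq_one_iff.1 h1 with h2 | h2
    · exact absurd ((h.pow_eq_one_iff_dvd 6).1 h2) (by norm_num)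
    · exact h2
  have h2 : ξ ^ 2 + 1 ≠ 0 := by
    intro h2
    have h4 : ξ ^ 4 = 1 := by linear_combination (ξ ^ 2 - 1) * h2
    exact absurd ((h.pow_eq_one_iff_dvd 4).1 h4) (by norm_num)
  have h4 : ξ ^ 4 - ξ ^ 2 + 1 = 0 := by
    have : (ξ ^ 2 + 1) * (ξ ^ 4 - ξ ^ 2 + 1) = 0 := by linear_combination h6
    exact (mul_eq_zero.1 this).resolve_left h2
  linear_combination (2 + ξ ^ 4) * h6 - h4

theorem primitive_eighth_sum {ξ : ℂ} (h : IsPrimitiveRoot ξ 8) : (ξ + ξ ^ 3) ^ 2 = -2 := by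
  have h4 : ξ ^ 4 = -1 := by
    have h1 : ξ ^ 4 * ξ ^ 4 = 1 := by rw [← pow_add]; exact h.pow_eq_one
    rcases mul_self_eq_one_iff.1 h1 with h2 | h2
    · exact absurd ((h.pow_eq_one_iff_dvd 4).1 h2) (by norm_num)
    · exact h2
  linear_combination (2 + ξ ^ 2) * h4

theorem star_eq_pow_sub {ξ : ℂ} {d b : ℕ} (h : IsPrimitiveRoot ξ d) (hd : d ≠ 0) (hb : b ≤ d) :
    star (ξ ^ b) = ξ ^ (d - b) := by
  have hn : ‖ξ ^ b‖ = 1 := by rw [norm_pow, h.norm'_eq_one hd, one_pow]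
  have h1 : ξ ^ b * star (ξ ^ b) = 1 := by
    rw [Complex.star_def, Complex.mul_conj, Complex.normSq_eq_norm_sq, hn]; simp
  have h2 : ξ ^ b * ξ ^ (d - b) = 1 := by rw [← pow_add, Nat.add_sub_cancel' hb, h.pow_eq_one]
  have h0 : ξ ^ b ≠ 0 := left_ne_zero_of_mul_eq_one h1
  exact mul_left_cancel₀ h0 (h1.trans h2.symm)

variable {D : ℤ}

/-- The contribution to a Reid-Tai sum of the conjugates over `ℚ(√D)` of a root of unity of order
at least `3` is at least `1`. -/
theorem one_le_sum_aroots_minpoly (hsq : Squarefree D) (hD : D < -3) {x : ℂ} {d : ℕ}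
    (hx : IsPrimitiveRoot x d) (hd : 3 ≤ d) {l : ℕ} (hl : 0 < l) (hdl : d ∣ l) {ζ : ℂ}
    (hζ : IsPrimitiveRoot ζ l) :
    1 ≤ (((minpoly (quadField D) x).aroots ℂ).map
      fun μ => ((sInf {k : ℕ | ζ ^ k = μ} : ℕ) : ℝ) / (l : ℝ)).sum := by
  obtain ⟨c, rfl⟩ := hdl
  have hD0 : D < 0 := by omega
  have hd0 : d ≠ 0 := by omega
  have : NeZero d := ⟨hd0⟩
  have hc : 0 < c := Nat.pos_of_mul_pos_left hl
  -- As `l = d c`, the root `ξ ^ b = ζ ^ (b c)` contributes `b c / (d c) = b / d`, so the sum is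
  -- computed with exponents modulo `d`.
  have hξ : IsPrimitiveRoot (ζ ^ c) d := hζ.pow hl (mul_comm d c)
  set ξ := ζ ^ c with hξdef
  have hxint : IsIntegral (quadField D) x :=
    ⟨X ^ d - C 1, monic_X_pow_sub_C _ hd0, by simp [hx.pow_eq_one]⟩
  set p := minpoly (quadField D) x with hp
  have hpm : p.Monic := minpoly.monic hxint
  have hpsep : (p.map (algebraMap (quadField D) ℂ)).Separable :=
    (minpoly.irreducible hxint).separable.map
  -- By separability the conjugates are distinct, and the root multiset is a finite set.
  set R : Finset ℂ := ⟨p.aroots ℂ, nodup_roots hpsep⟩ with hR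
  have hRmem : ∀ y, y ∈ R ↔ aeval y p = 0 := fun y => by
    change y ∈ p.aroots ℂ ↔ _
    rw [mem_aroots]
    exact and_iff_right hpm.ne_zero
  have hRd : ∀ y ∈ R, y ^ d = 1 := fun y hy => by
    have h1 : p ∣ X ^ d - C 1 := minpoly.dvd _ _ (by simp [hx.pow_eq_one])
    obtain ⟨r, hr⟩ := h1
    have h2 := congrArg (aeval y) hr
    rw [map_mul, (hRmem y).1 hy, zero_mul] at h2
    simpa [sub_eq_zero] using h2
  have hconj : ∀ {y z : ℂ}, IsPrimitiveRoot y d → IsPrimitiveRoot z d →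
      aeval z (minpoly ℚ y) = 0 := fun {y z} hy hz => by
    rw [← cyclotomic_eq_minpoly_rat hy (by omega), cyclotomic_eq_minpoly_rat hz (by omega)]
    exact minpoly.aeval _ _
  have hRprim : ∀ y ∈ R, IsPrimitiveRoot y d := fun y hy => by
    have h1 : p ∣ (minpoly ℚ x).map (algebraMap ℚ (quadField D)) :=
      minpoly.dvd_map_of_isScalarTower _ _ _
    obtain ⟨r, hr⟩ := h1
    have h2 := congrArg (aeval y) hr
    rw [map_mul, (hRmem y).1 hy, zero_mul, aeval_map_algebraMap,
      ← cyclotomic_eq_minpoly_rat hx (by omega), ← eval_map_algebraMap, map_cyclotomic] at h2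
    have : NeZero ((d : ℕ) : ℂ) := ⟨by exact_mod_cast hd0⟩
    exact isRoot_cyclotomic_iff.1 h2
  set S : Finset ℕ := (Finset.range d).filter fun b => ξ ^ b ∈ R with hSdef
  have hSmem : ∀ b, b ∈ S ↔ b < d ∧ ξ ^ b ∈ R := fun b => by simp [S]
  have hinj : Set.InjOn (fun b => ξ ^ b) (S : Set ℕ) := fun a ha b hb hab =>
    hξ.pow_inj ((hSmem a).1 ha).1 ((hSmem b).1 hb).1 hab
  have himage : S.image (fun b => ξ ^ b) = R := by
    ext y
    simp only [Finset.mem_image]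
    constructor
    · rintro ⟨b, hb, rfl⟩; exact ((hSmem b).1 hb).2
    · intro hy
      obtain ⟨b, hb, rfl⟩ := hξ.eq_pow_of_pow_eq_one (hRd y hy)
      exact ⟨b, (hSmem b).2 ⟨hb, hy⟩, rfl⟩
  have hcop : ∀ b ∈ S, b.Coprime d := fun b hb =>
    (hξ.pow_iff_coprime (by omega) b).1 (hRprim _ ((hSmem b).1 hb).2)
  have hpair : ∀ b, b < d → b.Coprime d → b ∈ S ∨ d - b ∈ S := fun b hb hbc => by
    have h1 : IsPrimitiveRoot (ξ ^ b) d := hξ.pow_of_coprime b hbc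
    rcases isRoot_or_isRoot_star hD0 p (minpoly.aeval _ x) (hconj hx h1) with h | h
    · left; exact (hSmem b).2 ⟨hb, (hRmem _).2 h⟩
    · right
      have hb0 : b ≠ 0 := by rintro rfl; simp at hbc; omega
      refine (hSmem _).2 ⟨by omega, (hRmem _).2 ?_⟩
      rw [← star_eq_pow_sub hξ hd0 hb.le]; exact h
  have hsplit : (p.map (algebraMap (quadField D) ℂ)).Splits := IsAlgClosed.splits _
  have hmonic := hpm.map (algebraMap (quadField D) ℂ)
  have hprod : ∏ y ∈ R, y = ξ ^ ∑ b ∈ S, b := by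
    rw [← himage, Finset.prod_image hinj, Finset.prod_pow_eq_pow_sum]
  have hprodK : ∏ y ∈ R, y ∈ quadField D := by
    have h1 := hsplit.coeff_zero_eq_prod_roots_of_monic hmonic
    have h2 : ∏ y ∈ R, y = (p.map (algebraMap (quadField D) ℂ)).roots.prod := by
      rw [Finset.prod, Multiset.map_id']
    have h3 : ∏ y ∈ R, y = (-1) ^ (p.map (algebraMap (quadField D) ℂ)).natDegree *
        (p.map (algebraMap (quadField D) ℂ)).coeff 0 := by
      rw [h1, ← mul_assoc, ← pow_add, ← two_mul, pow_mul, h2]; simp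
    rw [h3, coeff_map]
    exact mul_mem (pow_mem (neg_mem (one_mem _)) _) (SetLike.coe_mem (p.coeff 0))
  have hsumK : ∑ b ∈ S, ξ ^ b ∈ quadField D := by
    have h1 := hsplit.nextCoeff_eq_neg_sum_roots_of_monic hmonic
    have h2 : ∑ y ∈ R, y = (p.map (algebraMap (quadField D) ℂ)).roots.sum := by
      rw [Finset.sum, Multiset.map_id']
    have h3 : ∑ b ∈ S, ξ ^ b = ∑ y ∈ R, y := by rw [← himage, Finset.sum_image hinj]
    rw [h3, h2, ← neg_neg (Multiset.sum _), ← h1,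
      nextCoeff_map (algebraMap (quadField D) ℂ).injective]
    exact neg_mem (SetLike.coe_mem p.nextCoeff)
  have hsumR : (((minpoly (quadField D) x).aroots ℂ).map
      fun μ => ((sInf {k : ℕ | ζ ^ k = μ} : ℕ) : ℝ) / ((d * c : ℕ) : ℝ)).sum =
      ((∑ b ∈ S, b : ℕ) : ℝ) / d := by
    change ∑ μ ∈ R, ((sInf {k : ℕ | ζ ^ k = μ} : ℕ) : ℝ) / ((d * c : ℕ) : ℝ) = _
    rw [← himage, Finset.sum_image hinj, Nat.cast_sum, Finset.sum_div]
    refine Finset.sum_congr rfl fun b hb => ?_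
    have hbd : b * c < d * c := Nat.mul_lt_mul_of_pos_right ((hSmem b).1 hb).1 hc
    have h1 : ξ ^ b = ζ ^ (b * c) := by rw [hξdef, ← pow_mul, mul_comm]
    rw [h1, sInf_pow_eq hζ hbd]
    have hc' : (c : ℝ) ≠ 0 := by exact_mod_cast hc.ne'
    push_cast
    exact mul_div_mul_right _ _ hc'
  rw [hsumR, one_le_div (by exact_mod_cast (by omega : 0 < d))]
  norm_cast
  -- The norm `ξ ^ ∑ S` lies in `K` and is a root of unity, hence `±1`; its square is `1`.
  have hdvd : d ∣ 2 * ∑ b ∈ S, b := by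
    rw [← hξ.pow_eq_one_iff_dvd, mul_comm, pow_mul, ← hprod]
    have h1 : (∏ y ∈ R, y) ^ d = 1 := by
      rw [hprod, ← pow_mul, mul_comm, pow_mul, hξ.pow_eq_one, one_pow]
    rcases eq_one_or_neg_one_of_pow_eq_one hsq hD hprodK (by omega) h1 with h | h <;>
      rw [h] <;> norm_num
  have hpos : 0 < ∑ b ∈ S, b := by
    have hxR : x ∈ R := (hRmem x).2 (minpoly.aeval _ x)
    obtain ⟨b, hb, hbx⟩ := Finset.mem_image.1 (himage.symm ▸ hxR)
    have hb0 : b ≠ 0 := by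
      rintro rfl
      have := hcop 0 hb
      simp at this; omega
    exact (Nat.pos_of_ne_zero hb0).trans_le
      (Finset.single_le_sum (f := fun b => b) (fun _ _ => Nat.zero_le _) hb)
  obtain ⟨k, hk⟩ := hdvd
  -- `2 ∑ S = d k`, and the claim is `k ≥ 2`. The case `k = 1` leaves the two exceptional sets,
  -- where the trace `∑ ξ ^ b ∈ K` would be a square root of `-2` or of `-1`.
  by_cases hk1 : k = 1
  · exfalso
    rw [hk1, mul_one] at hk
    rcases eq_of_two_mul_sum_eq hd (fun b hb => ((hSmem b).1 hb).1) hcop hpair hk with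
      ⟨h8, hS8⟩ | ⟨h12, hS12⟩
    · rw [hS8, Finset.sum_pair (by norm_num), pow_one] at hsumK
      rw [h8] at hξ
      exact sq_ne_neg_two_of_mem hsq hD hsumK (primitive_eighth_sum hξ)
    · rw [hS12, Finset.sum_pair (by norm_num), pow_one] at hsumK
      rw [h12] at hξ
      have h1 := primitive_twelfth_sum hξ
      have h4 : (ξ + ξ ^ 5) ^ 4 = 1 := by
        rw [show (4 : ℕ) = 2 * 2 from rfl, pow_mul, h1]; norm_num
      rcases eq_one_or_neg_one_of_pow_eq_one hsq hD hsumK (by norm_num) h4 with h | h <;>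
        rw [h] at h1 <;> norm_num at h1
  · have hk0 : k ≠ 0 := by rintro rfl; omega
    have : d * 2 ≤ d * k := Nat.mul_le_mul_left d (by omega)
    omega

end RootsOfUnity

/-! ### Isometries of a definite hermitian form -/

section Definite

variable {ι : Type*} [Fintype ι]

theorem form_preserved {B Y : Matrix ι ι ℂ} (hY : Yᴴ * B * Y = B) (v w : ι → ℂ) :
    star (Y *ᵥ v) ⬝ᵥ B *ᵥ (Y *ᵥ w) = star v ⬝ᵥ B *ᵥ w := by
  rw [Matrix.star_mulVec, ← Matrix.dotProduct_mulVec, Matrix.mulVec_mulVec, Matrix.mulVec_mulVec,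
    hY]

variable [DecidableEq ι]

/-- A unipotent isometry of a definite hermitian form is the identity. -/
theorem eq_one_of_isNilpotent_sub_one {B Y : Matrix ι ι ℂ}
    (hB : ∀ y : ι → ℂ, (star y ⬝ᵥ B *ᵥ y).re ≤ 0 → y = 0)
    (hY : Yᴴ * B * Y = B) (hnil : IsNilpotent (Y - 1)) : Y = 1 := by
  -- If `u = (Y - 1) v` is fixed by `Y`, then `h(u, u) = h(Yv, Yu) - h(v, u) = 0`, so `u = 0`.
  -- Nilpotency exponents can thus be lowered to `1`.
  have step : ∀ v : ι → ℂ, (Y - 1) *ᵥ ((Y - 1) *ᵥ v) = 0 → (Y - 1) *ᵥ v = 0 := by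
    intro v hv
    refine hB _ (le_of_eq ?_)
    have h1 : Y *ᵥ ((Y - 1) *ᵥ v) = (Y - 1) *ᵥ v := by
      have : Y *ᵥ ((Y - 1) *ᵥ v) = (Y - 1) *ᵥ ((Y - 1) *ᵥ v) + (Y - 1) *ᵥ v := by
        rw [Matrix.sub_mulVec Y 1 ((Y - 1) *ᵥ v), Matrix.one_mulVec]; simp
      rw [this, hv, zero_add]
    have h2 := form_preserved hY v ((Y - 1) *ᵥ v)
    rw [h1] at h2
    have h3 : star ((Y - 1) *ᵥ v) = star (Y *ᵥ v) - star v := by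
      rw [Matrix.sub_mulVec, Matrix.one_mulVec, star_sub]
    rw [h3, sub_dotProduct, h2, sub_self, Complex.zero_re]
  obtain ⟨r, hr⟩ := hnil
  have key : ∀ r : ℕ, ∀ v : ι → ℂ, ((Y - 1) ^ r) *ᵥ v = 0 → (Y - 1) *ᵥ v = 0 := by
    intro r
    induction r with
    | zero => intro v hv; rw [pow_zero, Matrix.one_mulVec] at hv; rw [hv, Matrix.mulVec_zero]
    | succ r ih =>
      intro v hv
      refine step v (ih _ ?_)
      rw [Matrix.mulVec_mulVec, ← pow_succ, hv]
  have h0 : Y - 1 = 0 := by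
    refine Matrix.ext_of_mulVec_single fun i => ?_
    rw [key r _ (by rw [hr, Matrix.zero_mulVec]), Matrix.zero_mulVec]
  exact sub_eq_zero.1 h0

theorem exists_eigenvector {Y : Matrix ι ι ℂ} {x : ℂ} (hx : Y.charpoly.IsRoot x) :
    ∃ v : ι → ℂ, v ≠ 0 ∧ Y *ᵥ v = x • v := by
  rw [Polynomial.IsRoot, Matrix.eval_charpoly, ← Matrix.exists_mulVec_eq_zero_iff] at hx
  obtain ⟨v, hv0, hv⟩ := hx
  refine ⟨v, hv0, ?_⟩
  rw [Matrix.sub_mulVec, sub_eq_zero] at hv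
  rw [← hv]
  ext i; simp [Matrix.scalar_apply, Matrix.mulVec_diagonal]

theorem isRoot_charpoly_of_mulVec {Y : Matrix ι ι ℂ} {x : ℂ} {v : ι → ℂ} (hv0 : v ≠ 0)
    (hv : Y *ᵥ v = x • v) : Y.charpoly.IsRoot x := by
  rw [Polynomial.IsRoot, Matrix.eval_charpoly, ← Matrix.exists_mulVec_eq_zero_iff]
  refine ⟨v, hv0, ?_⟩
  rw [Matrix.sub_mulVec, hv, sub_eq_zero]
  ext i; simp [Matrix.scalar_apply, Matrix.mulVec_diagonal]

/-- For an eigenvector `v`, invariance gives `|x|² h(v, v) = h(v, v)`, and `h(v, v) ≠ 0` by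
definiteness. -/
theorem norm_eq_one_of_isRoot {B Y : Matrix ι ι ℂ}
    (hB : ∀ y : ι → ℂ, (star y ⬝ᵥ B *ᵥ y).re ≤ 0 → y = 0)
    (hY : Yᴴ * B * Y = B) {x : ℂ} (hx : Y.charpoly.IsRoot x) : ‖x‖ = 1 := by
  obtain ⟨v, hv0, hv⟩ := exists_eigenvector hx
  have h1 := form_preserved hY v v
  have h2 : (star v ⬝ᵥ B *ᵥ v) ≠ 0 := fun h => hv0 (hB v (by rw [h]; simp))
  rw [hv, star_smul, smul_dotProduct, Matrix.mulVec_smul, dotProduct_smul, smul_smul,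
    smul_eq_mul] at h1
  have h3 : star x * x = 1 := mul_right_cancel₀ h2 (by rw [h1, one_mul])
  have h4 : ((‖x‖ ^ 2 : ℝ) : ℂ) = 1 := by
    rw [← Complex.normSq_eq_norm_sq, ← h3, Complex.normSq_eq_conj_mul_self]; rfl
  have h5 : ‖x‖ ^ 2 = 1 := by exact_mod_cast h4
  exact (pow_eq_one_iff_of_nonneg (norm_nonneg x) two_ne_zero).1 h5

/-- Each factor `X - x` of the characteristic polynomial divides `X ^ N - 1`, so Cayley–Hamilton
kills a power of `Y ^ N - 1`. -/
theorem isNilpotent_pow_sub_one {Y : Matrix ι ι ℂ} {N : ℕ}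
    (h : ∀ x, Y.charpoly.IsRoot x → x ^ N = 1) : IsNilpotent (Y ^ N - 1) := by
  have hsplit : Y.charpoly.Splits := IsAlgClosed.splits _
  have h1 := hsplit.eq_prod_roots_of_monic Y.charpoly_monic
  have h2 : Y.charpoly ∣ (X ^ N - 1 : ℂ[X]) ^ Multiset.card Y.charpoly.roots := by
    have h3 : (Y.charpoly.roots.map fun _ => (X ^ N - 1 : ℂ[X])).prod =
        (X ^ N - 1 : ℂ[X]) ^ Multiset.card Y.charpoly.roots := by simp
    rw [← h3]
    nth_rewrite 1 [h1]
    refine Multiset.prod_dvd_prod_of_dvd _ _ fun x hx => ?_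
    rw [dvd_iff_isRoot]
    simp [h x (isRoot_of_mem_roots hx)]
  obtain ⟨r, hr⟩ := h2
  refine ⟨Multiset.card Y.charpoly.roots, ?_⟩
  have h4 := congrArg (aeval Y) hr
  rw [map_mul, Matrix.aeval_self_charpoly, zero_mul] at h4
  simpa using h4

/-- An isometry of a definite hermitian form whose eigenvalues are `N`-th roots of unity has
order dividing `N`. -/
theorem pow_eq_one_of_roots {B Y : Matrix ι ι ℂ}
    (hB : ∀ y : ι → ℂ, (star y ⬝ᵥ B *ᵥ y).re ≤ 0 → y = 0)
    (hY : Yᴴ * B * Y = B) {N : ℕ} (h : ∀ x, Y.charpoly.IsRoot x → x ^ N = 1) : Y ^ N = 1 := by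
  refine eq_one_of_isNilpotent_sub_one hB ?_ (isNilpotent_pow_sub_one h)
  clear h
  induction N with
  | zero => simp
  | succ N ih =>
    calc (Y ^ (N + 1))ᴴ * B * Y ^ (N + 1) = Yᴴ * ((Y ^ N)ᴴ * B * Y ^ N) * Y := by
          rw [pow_succ, Matrix.conjTranspose_mul]; simp only [Matrix.mul_assoc]
      _ = B := by rw [ih, hY]

theorem isRoot_pow_eq_one {Y : Matrix ι ι ℂ} {N : ℕ} (h : Y ^ N = 1) {x : ℂ}
    (hx : Y.charpoly.IsRoot x) : x ^ N = 1 := by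
  obtain ⟨v, hv0, hv⟩ := exists_eigenvector hx
  have key : ∀ k : ℕ, (Y ^ k) *ᵥ v = x ^ k • v := by
    intro k
    induction k with
    | zero => simp
    | succ k ih =>
      rw [pow_succ, ← Matrix.mulVec_mulVec, hv, Matrix.mulVec_smul, ih, smul_smul, pow_succ,
        mul_comm]
  have h1 := key N
  rw [h, Matrix.one_mulVec] at h1
  have h2 : (x ^ N - 1) • v = 0 := by rw [sub_smul, one_smul, ← h1, sub_self]
  exact sub_eq_zero.1 ((smul_eq_zero.1 h2).resolve_right hv0)

end Definite

/-! ### Block upper triangular matrices -/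

section UpperTriangular

variable {m : ℕ}

/-- A matrix of block form with rows `(u, v, w)`, `(0, X, y)`, `(0, 0, z)`. -/
structure IsUpper (M : Matrix (Fin (m + 2)) (Fin (m + 2)) ℂ) : Prop where
  mid_zero : ∀ i, M (mid i) 0 = 0
  last_zero : M (Fin.last (m + 1)) 0 = 0
  last_mid : ∀ i, M (Fin.last (m + 1)) (mid i) = 0

theorem mid_ne_zero (i : Fin m) : mid i ≠ 0 := by simp [mid, Fin.ext_iff]

theorem mid_ne_last (i : Fin m) : mid i ≠ Fin.last (m + 1) := by
  have := i.2
  simp only [mid, ne_eq, Fin.ext_iff, Fin.val_last, Fin.val_castSucc, Fin.val_succ]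
  omega

theorem mid_injective : Function.Injective (mid : Fin m → Fin (m + 2)) := fun i j h => by
  simpa [mid, Fin.ext_iff] using h

theorem zero_ne_last : (0 : Fin (m + 2)) ≠ Fin.last (m + 1) := by simp [Fin.ext_iff]

theorem mul_apply_index (M N : Matrix (Fin (m + 2)) (Fin (m + 2)) ℂ) (i j : Fin (m + 2)) :
    (M * N) i j = M i 0 * N 0 j + ∑ k, M i (mid k) * N (mid k) j +
      M i (Fin.last (m + 1)) * N (Fin.last (m + 1)) j := by
  rw [Matrix.mul_apply, CuspBasis.sum_index]

namespace IsUpper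

variable {M N : Matrix (Fin (m + 2)) (Fin (m + 2)) ℂ}

theorem one : IsUpper (1 : Matrix (Fin (m + 2)) (Fin (m + 2)) ℂ) :=
  ⟨fun i => Matrix.one_apply_ne (mid_ne_zero i), Matrix.one_apply_ne zero_ne_last.symm,
    fun i => Matrix.one_apply_ne (mid_ne_last i).symm⟩

theorem mul (hM : IsUpper M) (hN : IsUpper N) : IsUpper (M * N) := by
  refine ⟨fun i => ?_, ?_, fun i => ?_⟩ <;> rw [mul_apply_index] <;>
    simp [hM.mid_zero, hM.last_zero, hM.last_mid, hN.mid_zero, hN.last_zero, hN.last_mid]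

theorem sub (hM : IsUpper M) (hN : IsUpper N) : IsUpper (M - N) := by
  refine ⟨fun i => ?_, ?_, fun i => ?_⟩ <;>
    simp [hM.mid_zero, hM.last_zero, hM.last_mid, hN.mid_zero, hN.last_zero, hN.last_mid]

theorem pow (hM : IsUpper M) (k : ℕ) : IsUpper (M ^ k) := by
  induction k with
  | zero => simpa using one
  | succ k ih => rw [pow_succ]; exact ih.mul hM

theorem mul_zero_zero (hN : IsUpper N) : (M * N) 0 0 = M 0 0 * N 0 0 := by
  rw [mul_apply_index]; simp [hN.mid_zero, hN.last_zero]

theorem mul_last_last (hM : IsUpper M) :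
    (M * N) (Fin.last (m + 1)) (Fin.last (m + 1)) =
      M (Fin.last (m + 1)) (Fin.last (m + 1)) * N (Fin.last (m + 1)) (Fin.last (m + 1)) := by
  rw [mul_apply_index]; simp [hM.last_zero, hM.last_mid]

theorem mul_mid (hM : IsUpper M) (hN : IsUpper N) :
    (M * N).submatrix mid mid = M.submatrix mid mid * N.submatrix mid mid := by
  ext i j
  rw [Matrix.submatrix_apply, mul_apply_index, Matrix.mul_apply]
  simp [hM.mid_zero, hN.last_mid]

theorem pow_zero_zero (hM : IsUpper M) (k : ℕ) : (M ^ k) 0 0 = M 0 0 ^ k := by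
  induction k with
  | zero => simp
  | succ k ih => rw [pow_succ, hM.mul_zero_zero, ih, pow_succ]

theorem pow_last_last (hM : IsUpper M) (k : ℕ) :
    (M ^ k) (Fin.last (m + 1)) (Fin.last (m + 1)) =
      M (Fin.last (m + 1)) (Fin.last (m + 1)) ^ k := by
  induction k with
  | zero => simp
  | succ k ih => rw [pow_succ, (hM.pow k).mul_last_last, ih, pow_succ]

theorem pow_mid (hM : IsUpper M) (k : ℕ) :
    (M ^ k).submatrix mid mid = M.submatrix mid mid ^ k := by
  induction k with
  | zero => rw [pow_zero, pow_zero, Matrix.submatrix_one _ mid_injective]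
  | succ k ih => rw [pow_succ, (hM.pow k).mul_mid hM, ih, pow_succ]

end IsUpper

end UpperTriangular

/-! ### The Gram matrix at the cusp and its definite middle block -/

variable {D : ℤ} {m : ℕ} {L : HermitianLattice D (m + 1)}

/-- Hermitian symmetry is inherited from the real diagonal matrix to which the form is congruent. -/
theorem HermitianLattice.formC_conjTranspose (L : HermitianLattice D (m + 1)) :
    L.formCᴴ = L.formC := by
  obtain ⟨T, hT⟩ := L.signature
  have hT' : T.1ᴴ * L.formC * T.1 =
    Matrix.diagonal (Fin.snoc (fun _ : Fin (m + 1) => (1 : ℂ)) (-1 : ℂ)) := hT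
  have h2 : (T.1ᴴ * L.formC * T.1)ᴴ = T.1ᴴ * L.formC * T.1 := by
    rw [hT', Matrix.diagonal_conjTranspose]
    congr 1
    ext i
    induction i using Fin.lastCases with
    | last => simp
    | cast j => simp
  rw [Matrix.conjTranspose_mul, Matrix.conjTranspose_mul, Matrix.conjTranspose_conjTranspose,
    ← Matrix.mul_assoc] at h2
  have hTi : T.1 * (T⁻¹).1 = 1 := by rw [← Units.val_mul, mul_inv_cancel, Units.val_one]
  have hTs : (T⁻¹).1ᴴ * T.1ᴴ = 1 := by
    rw [← Matrix.conjTranspose_mul, hTi, Matrix.conjTranspose_one]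
  calc L.formCᴴ = ((T⁻¹).1ᴴ * T.1ᴴ) * L.formCᴴ * (T.1 * (T⁻¹).1) := by
        rw [hTs, hTi, one_mul, mul_one]
    _ = (T⁻¹).1ᴴ * (T.1ᴴ * L.formCᴴ * T.1) * (T⁻¹).1 := by simp only [Matrix.mul_assoc]
    _ = ((T⁻¹).1ᴴ * T.1ᴴ) * L.formC * (T.1 * (T⁻¹).1) := by
        rw [h2]; simp only [Matrix.mul_assoc]
    _ = L.formC := by rw [hTs, hTi, one_mul, mul_one]

namespace CuspBasis

theorem gram_conjTranspose (b : CuspBasis L) : b.gramᴴ = b.gram := by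
  have hG : b.gram = b.PC.1ᴴ * L.formC * b.PC.1 := rfl
  rw [hG, Matrix.conjTranspose_mul, Matrix.conjTranspose_mul, L.formC_conjTranspose,
    Matrix.conjTranspose_conjTranspose, Matrix.mul_assoc]

theorem star_gram (b : CuspBasis L) (i j : Fin (m + 2)) : star (b.gram i j) = b.gram j i := by
  conv_rhs => rw [← b.gram_conjTranspose]
  rfl

theorem gram_zero_zero' (b : CuspBasis L) : b.gram 0 0 = 0 := b.gram_zero_zero

theorem gram_zero_mid' (b : CuspBasis L) (i : Fin m) : b.gram 0 (mid i) = 0 := b.gram_zero_mid i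

theorem gram_mid_last' (b : CuspBasis L) (i : Fin m) :
    b.gram (mid i) (Fin.last (m + 1)) = 0 := b.gram_mid_last i

theorem gram_last_last' (b : CuspBasis L) :
    b.gram (Fin.last (m + 1)) (Fin.last (m + 1)) = 0 := b.gram_last_last

theorem gram_mid_zero (b : CuspBasis L) (i : Fin m) : b.gram (mid i) 0 = 0 := by
  rw [← star_gram, b.gram_zero_mid', star_zero]

theorem gram_last_mid (b : CuspBasis L) (i : Fin m) :
    b.gram (Fin.last (m + 1)) (mid i) = 0 := by
  rw [← star_gram, b.gram_mid_last', star_zero]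

theorem gram_zero_last (b : CuspBasis L) : b.gram 0 (Fin.last (m + 1)) = b.a := rfl

theorem gram_last_zero (b : CuspBasis L) : b.gram (Fin.last (m + 1)) 0 = star b.a := by
  rw [← star_gram, b.gram_zero_last]

/-- The middle block `B` of the Gram matrix. -/
noncomputable def midGram (b : CuspBasis L) : Matrix (Fin m) (Fin m) ℂ :=
  b.gram.submatrix mid mid

/-- There is a coordinate hyperplane, in suitable coordinates, on which `h` is positive definite. -/
theorem exists_functional (b : CuspBasis L) : ∃ φ : (Fin (m + 2) → ℂ) →ₗ[ℂ] ℂ,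
    ∀ x, φ x = 0 → (star x ⬝ᵥ b.gram *ᵥ x).re ≤ 0 → x = 0 := by
  obtain ⟨T, hT⟩ := L.signature
  have hT' : T.1ᴴ * L.formC * T.1 =
    Matrix.diagonal (Fin.snoc (fun _ : Fin (m + 1) => (1 : ℂ)) (-1 : ℂ)) := hT
  set J := Matrix.diagonal (Fin.snoc (fun _ : Fin (m + 1) => (1 : ℂ)) (-1 : ℂ) : Fin (m + 2) → ℂ)
  set S : GL (Fin (m + 2)) ℂ := T⁻¹ * b.PC with hS
  have hTS : T.1 * S.1 = b.PC.1 := by rw [← Units.val_mul, hS, mul_inv_cancel_left]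
  have hG : b.gram = S.1ᴴ * J * S.1 := by
    have : b.gram = b.PC.1ᴴ * L.formC * b.PC.1 := rfl
    rw [this, ← hTS, ← hT', Matrix.conjTranspose_mul]
    simp only [Matrix.mul_assoc]
  -- The functional is the negative coordinate in a diagonalising basis; on its kernel `h` is a sum
  -- of squares of absolute values.
  refine ⟨(LinearMap.proj (Fin.last (m + 1))).comp (Matrix.toLin' S.1), fun x hx hle => ?_⟩
  have hx' : (S.1 *ᵥ x) (Fin.last (m + 1)) = 0 := hx
  have h1 : star x ⬝ᵥ b.gram *ᵥ x = star (S.1 *ᵥ x) ⬝ᵥ J *ᵥ (S.1 *ᵥ x) := by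
    rw [hG, Matrix.star_mulVec, ← Matrix.dotProduct_mulVec, Matrix.mulVec_mulVec,
      Matrix.mulVec_mulVec]
  have h2 : (star (S.1 *ᵥ x) ⬝ᵥ J *ᵥ (S.1 *ᵥ x)).re =
      ∑ i : Fin (m + 1), Complex.normSq ((S.1 *ᵥ x) i.castSucc) := by
    rw [dotProduct, Fin.sum_univ_castSucc]
    simp only [J, Matrix.mulVec_diagonal, Fin.snoc_castSucc, one_mul, Pi.star_apply,
      hx', mul_zero, add_zero, Complex.re_sum]
    refine Finset.sum_congr rfl fun i _ => ?_
    rw [Complex.star_def, ← Complex.normSq_eq_conj_mul_self, Complex.ofReal_re]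
  rw [h1, h2] at hle
  have h3 : ∑ i : Fin (m + 1), Complex.normSq ((S.1 *ᵥ x) i.castSucc) = 0 :=
    le_antisymm hle (Finset.sum_nonneg fun _ _ => Complex.normSq_nonneg _)
  rw [Finset.sum_eq_zero_iff_of_nonneg fun _ _ => Complex.normSq_nonneg _] at h3
  have h4 : S.1 *ᵥ x = 0 := by
    ext i
    induction i using Fin.lastCases with
    | last => exact hx'
    | cast j => exact Complex.normSq_eq_zero.1 (h3 j (Finset.mem_univ _))
  calc x = (S⁻¹).1 *ᵥ (S.1 *ᵥ x) := by
        rw [Matrix.mulVec_mulVec, ← Units.val_mul, inv_mul_cancel, Units.val_one,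
          Matrix.one_mulVec]
    _ = 0 := by rw [h4, Matrix.mulVec_zero]

/-- The middle block of the Gram matrix is positive definite. -/
theorem midGram_definite (b : CuspBasis L) (y : Fin m → ℂ)
    (hy : (star y ⬝ᵥ b.midGram *ᵥ y).re ≤ 0) : y = 0 := by
  obtain ⟨φ, hφ⟩ := b.exists_functional
  -- If `B(y, y) ≤ 0` with `y ≠ 0`, then `h` is nonpositive on the plane of the vectors `(α, β y,
  -- 0)`, which must meet the kernel of `φ` nontrivially; signature `(n, 1)` forbids this.
  let vec : ℂ → ℂ → Fin (m + 2) → ℂ := fun α β =>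
    Fin.snoc (Fin.cons α (β • y) : Fin (m + 1) → ℂ) 0
  have v0 : ∀ α β, vec α β 0 = α := fun α β => by
    have : (0 : Fin (m + 2)) = Fin.castSucc 0 := rfl
    simp only [vec]
    rw [this, Fin.snoc_castSucc, Fin.cons_zero]
  have vm : ∀ α β i, vec α β (mid i) = β * y i := fun α β i => by
    simp only [vec]
    rw [mid, Fin.snoc_castSucc, Fin.cons_succ]; rfl
  have vl : ∀ α β, vec α β (Fin.last (m + 1)) = 0 := fun α β => by simp [vec]
  have hlin : ∀ α β, vec α β = α • vec 1 0 + β • vec 0 1 := fun α β => by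
    ext i
    revert i
    refine index_cases ?_ (fun i => ?_) ?_ <;> simp [v0, vm, vl]
  have hq : ∀ α β, star (vec α β) ⬝ᵥ b.gram *ᵥ vec α β =
      (Complex.normSq β : ℂ) * (star y ⬝ᵥ b.midGram *ᵥ y) := fun α β => by
    have hrow : ∀ i, (b.gram *ᵥ vec α β) (mid i) = β * (b.midGram *ᵥ y) i := fun i => by
      rw [Matrix.mulVec, dotProduct, sum_index, Matrix.mulVec, dotProduct, Finset.mul_sum]
      simp only [v0, vm, vl, gram_mid_zero, zero_mul, mul_zero, add_zero, zero_add]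
      refine Finset.sum_congr rfl fun j _ => ?_
      change _ = β * (b.gram (mid i) (mid j) * y j)
      ring
    have hrow0 : (b.gram *ᵥ vec α β) 0 = 0 := by
      rw [Matrix.mulVec, dotProduct, sum_index]
      simp [vl, gram_zero_zero', gram_zero_mid']
    rw [dotProduct, sum_index, hrow0]
    simp only [hrow, Pi.star_apply, vm, vl, star_zero, zero_mul, mul_zero, add_zero, zero_add]
    rw [dotProduct, Finset.mul_sum]
    refine Finset.sum_congr rfl fun j _ => ?_
    rw [Complex.normSq_eq_conj_mul_self, star_mul', Pi.star_apply, Complex.star_def]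
    ring
  have hneg : ∀ α β, (star (vec α β) ⬝ᵥ b.gram *ᵥ vec α β).re ≤ 0 := fun α β => by
    rw [hq, Complex.re_ofReal_mul]
    exact mul_nonpos_of_nonneg_of_nonpos (Complex.normSq_nonneg _) hy
  have h1 : vec (φ (vec 0 1)) (-φ (vec 1 0)) = 0 := by
    refine hφ _ ?_ (hneg _ _)
    rw [hlin, map_add, map_smul, map_smul, smul_eq_mul, smul_eq_mul]; ring
  by_contra hy0
  obtain ⟨i, hi⟩ := Function.ne_iff.1 hy0
  have h2 := congrFun h1 (mid i)
  rw [vm] at h2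
  have h3 : φ (vec 1 0) = 0 := by
    simpa using (mul_eq_zero.1 h2).resolve_right hi
  have h4 := congrFun (hφ _ h3 (hneg _ _)) 0
  rw [v0] at h4
  exact one_ne_zero h4

/-! ### The matrices of elements of `N(F)` -/

theorem mat_one (b : CuspBasis L) : b.mat 1 = 1 := by simp [mat]

theorem mat_mul (b : CuspBasis L) (g h : GL (Fin (m + 2)) ℂ) :
    b.mat (g * h) = b.mat g * b.mat h := by
  rw [mat, mat, mat, ← Units.val_mul]; congr 1; group

theorem mat_pow (b : CuspBasis L) (g : GL (Fin (m + 2)) ℂ) (k : ℕ) :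
    b.mat (g ^ k) = b.mat g ^ k := by
  induction k with
  | zero => simp [mat_one]
  | succ k ih => rw [pow_succ, mat_mul, ih, pow_succ]

theorem mat_injective (b : CuspBasis L) : Function.Injective b.mat := fun g h hgh => by
  have h1 : b.PC⁻¹ * g * b.PC = b.PC⁻¹ * h * b.PC := Units.ext hgh
  simpa using h1

theorem sub_one_eq (b : CuspBasis L) (g : GL (Fin (m + 2)) ℂ) :
    b.mat g - 1 = (b.PC⁻¹).1 * (g.1 - 1) * b.PC.1 := by
  rw [mat, mul_sub, sub_mul, mul_one, ← Units.val_mul, ← Units.val_mul, ← Units.val_mul,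
    inv_mul_cancel, Units.val_one]

theorem isNilpotent_mat_sub_one_iff (b : CuspBasis L) (g : GL (Fin (m + 2)) ℂ) :
    IsNilpotent (b.mat g - 1) ↔ IsNilpotent (g.1 - 1) := by
  have h : ∀ r : ℕ, (b.mat g - 1) ^ r = (b.PC⁻¹).1 * (g.1 - 1) ^ r * b.PC.1 := fun r => by
    rw [sub_one_eq]
    have := Units.conj_pow (b.PC⁻¹) (g.1 - 1) r
    rwa [inv_inv] at this
  constructor
  · rintro ⟨r, hr⟩
    refine ⟨r, ?_⟩
    rw [h] at hr
    have h1 : b.PC.1 * (b.PC⁻¹).1 = 1 := by rw [← Units.val_mul, mul_inv_cancel, Units.val_one]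
    calc (g.1 - 1) ^ r = (b.PC.1 * (b.PC⁻¹).1) * (g.1 - 1) ^ r * (b.PC.1 * (b.PC⁻¹).1) := by
          rw [h1, one_mul, mul_one]
      _ = b.PC.1 * ((b.PC⁻¹).1 * (g.1 - 1) ^ r * b.PC.1) * (b.PC⁻¹).1 := by
          simp only [Matrix.mul_assoc]
      _ = 0 := by rw [hr, mul_zero, zero_mul]
  · rintro ⟨r, hr⟩
    exact ⟨r, by rw [h, hr, mul_zero, zero_mul]⟩

theorem isUpper_mat (b : CuspBasis L) {g : GL (Fin (m + 2)) ℂ} (hg : g ∈ lineStabilizer L b.e) :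
    IsUpper (b.mat g) :=
  ⟨(b.mat_shape hg).1, (b.mat_shape hg).2.1, (b.mat_shape hg).2.2.1⟩

theorem star_mul_mat (b : CuspBasis L) {g : GL (Fin (m + 2)) ℂ}
    (hg : g ∈ lineStabilizer L b.e) :
    star (b.mat g 0 0) * b.mat g (Fin.last (m + 1)) (Fin.last (m + 1)) = 1 :=
  (b.mat_shape hg).2.2.2

theorem mat_last_ne_zero (b : CuspBasis L) {g : GL (Fin (m + 2)) ℂ}
    (hg : g ∈ lineStabilizer L b.e) : b.mat g (Fin.last (m + 1)) (Fin.last (m + 1)) ≠ 0 :=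
  right_ne_zero_of_mul_eq_one (b.star_mul_mat hg)

theorem gram_mul_mat_mid (b : CuspBasis L) (g : GL (Fin (m + 2)) ℂ) (i : Fin m) (j : Fin (m + 2)) :
    (b.gram * b.mat g) (mid i) j = ∑ k, b.gram (mid i) (mid k) * b.mat g (mid k) j := by
  rw [mul_apply_index, gram_mid_zero, gram_mid_last']; simp

theorem gram_mul_mat_zero (b : CuspBasis L) (g : GL (Fin (m + 2)) ℂ) (j : Fin (m + 2)) :
    (b.gram * b.mat g) 0 j = b.a * b.mat g (Fin.last (m + 1)) j := by
  rw [mul_apply_index, gram_zero_zero', gram_zero_last]; simp [gram_zero_mid']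

theorem gram_mul_mat_last (b : CuspBasis L) (g : GL (Fin (m + 2)) ℂ) (j : Fin (m + 2)) :
    (b.gram * b.mat g) (Fin.last (m + 1)) j = star b.a * b.mat g 0 j := by
  rw [mul_apply_index, gram_last_last', gram_last_zero]; simp [gram_last_mid]

theorem mat_unitary_apply (b : CuspBasis L) {g : GL (Fin (m + 2)) ℂ}
    (hg : g ∈ lineStabilizer L b.e) (i j : Fin (m + 2)) :
    star (b.mat g 0 i) * (b.a * b.mat g (Fin.last (m + 1)) j) +
      ∑ k, star (b.mat g (mid k) i) * (∑ l, b.gram (mid k) (mid l) * b.mat g (mid l) j) +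
      star (b.mat g (Fin.last (m + 1)) i) * (star b.a * b.mat g 0 j) = b.gram i j := by
  have h := congrFun (congrFun (b.mat_unitary hg.1) i) j
  rw [Matrix.mul_assoc, mul_apply_index, gram_mul_mat_zero, gram_mul_mat_last] at h
  simpa only [gram_mul_mat_mid b g, Matrix.conjTranspose_apply] using h

/-- The middle block of an element of `N(F)` is an isometry of `B`. -/
theorem mid_unitary (b : CuspBasis L) {g : GL (Fin (m + 2)) ℂ}
    (hg : g ∈ lineStabilizer L b.e) :
    ((b.mat g).submatrix mid mid)ᴴ * b.midGram * (b.mat g).submatrix mid mid = b.midGram := by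
  ext i j
  have h := b.mat_unitary_apply hg (mid i) (mid j)
  rw [(b.isUpper_mat hg).last_mid, (b.isUpper_mat hg).last_mid] at h
  simp only [mul_zero, zero_add, star_zero, zero_mul, add_zero] at h
  rw [Matrix.mul_assoc, Matrix.mul_apply, midGram, Matrix.submatrix_apply, ← h]
  rfl

/-- The images of a middle and of the last basis vector stay orthogonal; for `y = 0` this reads
`star v_i * a * z = 0`. -/
theorem mat_zero_mid_eq_zero (b : CuspBasis L) {g : GL (Fin (m + 2)) ℂ}
    (hg : g ∈ lineStabilizer L b.e) (hy : ∀ i, b.mat g (mid i) (Fin.last (m + 1)) = 0)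
    (i : Fin m) : b.mat g 0 (mid i) = 0 := by
  have h := b.mat_unitary_apply hg (mid i) (Fin.last (m + 1))
  rw [(b.isUpper_mat hg).last_mid, gram_mid_last'] at h
  simpa [hy, b.a_ne_zero, b.mat_last_ne_zero hg] using h

/-- The image of the last basis vector stays isotropic: `2 Re(ā w) + B(y, y) = 0`. Hence, by
definiteness of `B`, `w ∈ i a ℝ` is equivalent to `y = 0`. -/
theorem mat_last_last_eq (b : CuspBasis L) {g : GL (Fin (m + 2)) ℂ}
    (hg : g ∈ lineStabilizer L b.e) (hz : b.mat g (Fin.last (m + 1)) (Fin.last (m + 1)) = 1) :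
    star (b.mat g 0 (Fin.last (m + 1))) * b.a + star b.a * b.mat g 0 (Fin.last (m + 1)) +
      star (fun i => b.mat g (mid i) (Fin.last (m + 1))) ⬝ᵥ b.midGram *ᵥ
        (fun i => b.mat g (mid i) (Fin.last (m + 1))) = 0 := by
  have h := b.mat_unitary_apply hg (Fin.last (m + 1)) (Fin.last (m + 1))
  rw [hz, gram_last_last', star_one, one_mul, mul_one] at h
  rw [← h, add_right_comm]
  rfl

/-- The diagonal blocks of a nilpotent block triangular matrix are nilpotent; in the middle, a
unipotent isometry of the definite form `B` is trivial. -/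
theorem mat_diagonal_of_unipotent (b : CuspBasis L) {g : GL (Fin (m + 2)) ℂ}
    (hg : g ∈ unipotentRadical L b.e) :
    b.mat g 0 0 = 1 ∧ b.mat g (Fin.last (m + 1)) (Fin.last (m + 1)) = 1 ∧
      (b.mat g).submatrix mid mid = 1 := by
  obtain ⟨r, hr⟩ := (b.isNilpotent_mat_sub_one_iff g).2 hg.2
  have hU := (b.isUpper_mat hg.1).sub IsUpper.one
  refine ⟨?_, ?_, ?_⟩
  · have h := hU.pow_zero_zero r
    rw [hr, Matrix.zero_apply] at h
    have := eq_zero_of_pow_eq_zero h.symm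
    simpa [sub_eq_zero] using this
  · have h := hU.pow_last_last r
    rw [hr, Matrix.zero_apply] at h
    have := eq_zero_of_pow_eq_zero h.symm
    simpa [sub_eq_zero] using this
  · refine eq_one_of_isNilpotent_sub_one b.midGram_definite (b.mid_unitary hg.1) ⟨r, ?_⟩
    have h := hU.pow_mid r
    rw [hr] at h
    have h1 : (b.mat g - 1).submatrix mid mid = (b.mat g).submatrix mid mid - 1 := by
      rw [Matrix.submatrix_sub, Pi.sub_apply, Pi.sub_apply, Matrix.submatrix_one _ mid_injective]
    rw [← h1, ← h]; rfl

/-- The elements of `N(F)` acting by translations of `α` belong to `U(F)`. -/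
theorem mem_centerUnipotent (b : CuspBasis L) {g : GL (Fin (m + 2)) ℂ}
    (hg : g ∈ lineStabilizer L b.e) {w : ℂ}
    (hw : b.mat g = 1 + Matrix.single 0 (Fin.last (m + 1)) w) : g ∈ centerUnipotent L b.e := by
  refine ⟨⟨hg, (b.isNilpotent_mat_sub_one_iff g).1 ⟨2, ?_⟩⟩, fun k hk => b.mat_injective ?_⟩
  · rw [hw, add_sub_cancel_left, sq, Matrix.single_mul_single_of_ne w 0 _ _ zero_ne_last.symm w]
  · obtain ⟨hu, hz, -⟩ := b.mat_diagonal_of_unipotent hk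
    have hU := b.isUpper_mat hk.1
    rw [mat_mul, mat_mul, hw, add_mul, mul_add, one_mul, mul_one]
    congr 1
    ext i j
    rw [mul_apply_index, mul_apply_index]
    simp only [Matrix.single_apply]
    revert i j
    refine index_cases ?_ (fun i => ?_) ?_ <;> refine index_cases ?_ (fun j => ?_) ?_ <;>
      simp [hu, hz, hU.mid_zero, hU.last_zero, hU.last_mid, (mid_ne_zero _).symm,
        (mid_ne_last _).symm, zero_ne_last.symm]

/-! ### Translations and the torus coordinate -/

theorem mat_mid_last_of_translation (b : CuspBasis L) {g : GL (Fin (m + 2)) ℂ}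
    (hg : g ∈ unipotentRadical L b.e) {x : ℝ}
    (hx : b.mat g 0 (Fin.last (m + 1)) = Complex.I * b.a * (x : ℂ)) (i : Fin m) :
    b.mat g (mid i) (Fin.last (m + 1)) = 0 := by
  have h := b.mat_last_last_eq hg.1 (b.mat_diagonal_of_unipotent hg).2.1
  have h0 : star (Complex.I * b.a * (x : ℂ)) * b.a + star b.a * (Complex.I * b.a * (x : ℂ)) =
      0 := by
    simp only [star_mul', Complex.star_def, Complex.conj_I, Complex.conj_ofReal]; ring
  rw [hx, h0, zero_add] at h
  exact congrFun (b.midGram_definite _ (by rw [h]; simp)) i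

/-- The real numbers `x` for which `α ↦ α + i a x` is given by an element of `U(F)_ℤ`. -/
def translations (b : CuspBasis L) (Γ : Subgroup (GL (Fin (m + 2)) ℂ)) : AddSubgroup ℝ where
  carrier := {x | ∃ g ∈ centerUnipotent L b.e ⊓ Γ,
    b.mat g 0 (Fin.last (m + 1)) = Complex.I * b.a * (x : ℂ)}
  zero_mem' := ⟨1, one_mem _, by rw [mat_one, Matrix.one_apply_ne zero_ne_last]; simp⟩
  add_mem' := by
    rintro x y ⟨g, hg, hgx⟩ ⟨h, hh, hhy⟩
    refine ⟨g * h, mul_mem hg hh, ?_⟩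
    rw [mat_mul, mul_apply_index, (b.mat_diagonal_of_unipotent hg.1.1).1,
      (b.mat_diagonal_of_unipotent hh.1.1).2.1, hgx, hhy]
    -- The cross term `∑ v_k y_k` of the product vanishes because `y = 0` for a translation.
    simp only [b.mat_mid_last_of_translation hh.1.1 hhy]
    push_cast
    simp; ring
  neg_mem' := by
    rintro x ⟨g, hg, hgx⟩
    refine ⟨g⁻¹, inv_mem hg, ?_⟩
    have h1 := congrFun (congrFun (b.mat_mul g⁻¹ g) 0) (Fin.last (m + 1))
    rw [inv_mul_cancel, mat_one, Matrix.one_apply_ne zero_ne_last, mul_apply_index,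
      (b.mat_diagonal_of_unipotent (inv_mem hg).1.1).1,
      (b.mat_diagonal_of_unipotent hg.1.1).2.1, hgx] at h1
    simp only [b.mat_mid_last_of_translation hg.1.1 hgx, mul_zero, Finset.sum_const_zero, one_mul,
      add_zero, mul_one] at h1
    push_cast
    linear_combination -h1

/-- `exp_a` is invariant under the translations in `U(F)_ℤ`, which are the integral multiples of
`σ`; when there are none, `x = 0`. -/
theorem expA_eq_one (b : CuspBasis L) {Γ : Subgroup (GL (Fin (m + 2)) ℂ)} {x : ℝ}
    (hx : x ∈ b.translations Γ) : b.expA Γ (Complex.I * b.a * (x : ℂ)) = 1 := by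
  have hper : b.period Γ = sInf {y : ℝ | y ∈ b.translations Γ ∧ 0 < y} := by
    rw [period]
    congr 1
    ext y
    exact and_comm
  rw [expA, sigma]
  -- A zero infimum makes `σ = 0`, and with `2πi / 0 = 0` the function `exp_a` is constantly `1`.
  by_cases hc : b.period Γ = 0
  · simp [hc]
  have hnn : 0 ≤ b.period Γ := by
    rw [hper]; exact Real.sInf_nonneg fun y hy => hy.2.le
  have hpos : 0 < b.period Γ := lt_of_le_of_ne hnn (Ne.symm hc)
  by_cases hbot : b.translations Γ = ⊥
  · have : x = 0 := by rwa [hbot, AddSubgroup.mem_bot] at hx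
    simp [this]
  -- A positive infimum leaves a gap next to `0`, so the translation group is cyclic, generated by
  -- its least positive element, the period.
  have hdisj : Disjoint (b.translations Γ : Set ℝ) (Set.Ioo 0 (b.period Γ)) := by
    rw [Set.disjoint_left]
    intro y hy hy'
    refine absurd hy'.2 (not_lt.2 ?_)
    rw [hper]
    exact csInf_le ⟨0, fun z hz => hz.2.le⟩ ⟨hy, hy'.1⟩
  obtain ⟨c, hcl⟩ := AddSubgroup.exists_isLeast_pos hbot hpos hdisj
  have hcp : b.period Γ = c := by rw [hper]; exact hcl.csInf_eq
  rw [AddSubgroup.cyclic_of_min hcl, AddSubgroup.mem_closure_singleton] at hx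
  obtain ⟨k, rfl⟩ := hx
  rw [Complex.exp_eq_one_iff]
  refine ⟨k, ?_⟩
  rw [hcp] at hc ⊢
  have hc' : (c : ℂ) ≠ 0 := by exact_mod_cast hc
  have ha := b.a_ne_zero
  have hI := Complex.I_ne_zero
  simp only [zsmul_eq_mul, Complex.ofReal_mul, Complex.ofReal_intCast]
  field_simp

theorem expA_nat_mul (b : CuspBasis L) (Γ : Subgroup (GL (Fin (m + 2)) ℂ)) (k : ℕ) (α : ℂ) :
    b.expA Γ (k * α) = b.expA Γ α ^ k := by
  rw [expA, expA, ← Complex.exp_nat_mul]; congr 1; ring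

/-! ### The data of an element of `N(F)` at a fixed boundary point -/

/-- The linear part `X / z` of the action on the boundary. -/
noncomputable def rotation (b : CuspBasis L) (g : GL (Fin (m + 2)) ℂ) : Matrix (Fin m) (Fin m) ℂ :=
  (b.mat g (Fin.last (m + 1)) (Fin.last (m + 1)))⁻¹ • (b.mat g).submatrix mid mid

/-- The translation of `α` over the boundary point `w₀`. -/
noncomputable def twist (b : CuspBasis L) (g : GL (Fin (m + 2)) ℂ) (w₀ : Fin m → ℂ) : ℂ :=
  (∑ j, b.mat g 0 (mid j) * w₀ j + b.mat g 0 (Fin.last (m + 1))) /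
    b.mat g (Fin.last (m + 1)) (Fin.last (m + 1))

theorem rotation_apply (b : CuspBasis L) (g : GL (Fin (m + 2)) ℂ) (i j : Fin m) :
    b.rotation g i j =
      b.mat g (mid i) (mid j) / b.mat g (Fin.last (m + 1)) (Fin.last (m + 1)) := by
  rw [rotation, Matrix.smul_apply, smul_eq_mul, div_eq_inv_mul]; rfl

theorem rotation_pow (b : CuspBasis L) {g : GL (Fin (m + 2)) ℂ}
    (hg : g ∈ lineStabilizer L b.e) (k : ℕ) : b.rotation (g ^ k) = b.rotation g ^ k := by
  rw [rotation, rotation, mat_pow, (b.isUpper_mat hg).pow_last_last, (b.isUpper_mat hg).pow_mid,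
    _root_.smul_pow, inv_pow]

variable {Γ : Subgroup (GL (Fin (m + 2)) ℂ)} {g : GL (Fin (m + 2)) ℂ}

theorem isIntegral_mat_last (b : CuspBasis L) (hg : g ∈ lineStabilizer L b.e)
    (hgL : g ∈ L.unitaryGroup) :
    IsIntegral ℤ (b.mat g (Fin.last (m + 1)) (Fin.last (m + 1))) := by
  have hU := b.isUpper_mat hg
  refine isIntegral_of_isRoot hgL ?_
  rw [← b.charpoly_mat, Polynomial.IsRoot, Matrix.eval_charpoly]
  refine Matrix.det_eq_zero_of_row_eq_zero (Fin.last (m + 1)) ?_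
  refine index_cases ?_ (fun i => ?_) ?_
  · simp [hU.last_zero, Fin.ext_iff]
  · simp [hU.last_mid, (mid_ne_last i).symm]
  · simp

theorem mat_last_sq (hsq : Squarefree D) (hD : D < -3) (b : CuspBasis L)
    (hg : g ∈ lineStabilizer L b.e) (hgL : g ∈ L.unitaryGroup) :
    b.mat g (Fin.last (m + 1)) (Fin.last (m + 1)) ^ 2 = 1 := by
  have h1 := b.star_mul_mat hg
  rw [b.mat_zero_zero_eq (by omega) hg hgL] at h1
  have h2 : Complex.normSq (b.mat g (Fin.last (m + 1)) (Fin.last (m + 1))) = 1 := by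
    rw [Complex.star_def, ← Complex.normSq_eq_conj_mul_self] at h1
    exact_mod_cast h1
  rcases eq_one_or_neg_one_of_isIntegral hsq hD (b.mat_mem hgL _ _)
    (b.isIntegral_mat_last hg hgL) h2 with h | h <;> rw [h] <;> norm_num

/-- `X` is an isometry of `B`, and dividing by `z` is harmless since `u = z` and `ū z = 1` give `|z|
= 1`. -/
theorem rotation_unitary (hD : D < 0) (b : CuspBasis L)
    (hg : g ∈ lineStabilizer L b.e) (hgL : g ∈ L.unitaryGroup) :
    (b.rotation g)ᴴ * b.midGram * b.rotation g = b.midGram := by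
  have h1 := b.star_mul_mat hg
  rw [b.mat_zero_zero_eq hD hg hgL] at h1
  rw [rotation, Matrix.conjTranspose_smul, Matrix.smul_mul, Matrix.smul_mul, Matrix.mul_smul,
    b.mid_unitary hg, smul_smul, star_inv₀, ← mul_inv, h1, inv_one, one_smul]

theorem exists_charpoly_rotation (b : CuspBasis L) (hgL : g ∈ L.unitaryGroup) :
    ∃ q : (quadField D)[X],
      q.map (algebraMap (quadField D) ℂ) = (b.rotation g).charpoly := by
  let R : Matrix (Fin m) (Fin m) (quadField D) := fun i j =>
    ⟨b.rotation g i j, by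
      rw [rotation_apply]; exact div_mem (b.mat_mem hgL _ _) (b.mat_mem hgL _ _)⟩
  refine ⟨R.charpoly, ?_⟩
  rw [← Matrix.charpoly_map]
  rfl

/-- `x z` is an eigenvalue of `X`, hence of the lattice automorphism `g`, and so integral; `x = (x
z) z` because `z² = 1`. -/
theorem isIntegral_of_isRoot_rotation (hsq : Squarefree D) (hD : D < -3) (b : CuspBasis L)
    (hg : g ∈ lineStabilizer L b.e) (hgL : g ∈ L.unitaryGroup) {x : ℂ}
    (hx : (b.rotation g).charpoly.IsRoot x) : IsIntegral ℤ x := by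
  have hU := b.isUpper_mat hg
  have hzi := b.isIntegral_mat_last hg hgL
  have hz2 := b.mat_last_sq hsq hD hg hgL
  have hz0 := b.mat_last_ne_zero hg
  have huz := b.mat_zero_zero_eq (by omega) hg hgL
  obtain ⟨y, hy0, hy⟩ := exists_eigenvector hx
  set M := b.mat g with hM
  set z := M (Fin.last (m + 1)) (Fin.last (m + 1)) with hz
  have hX : ∀ i, ∑ j, M (mid i) (mid j) * y j = x * z * y i := fun i => by
    have h := congrFun hy i
    rw [rotation, Matrix.smul_mulVec, Pi.smul_apply, smul_eq_mul, ← hM, ← hz,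
      inv_mul_eq_iff_eq_mul₀ hz0] at h
    rw [Pi.smul_apply, smul_eq_mul] at h
    calc _ = _ := h
      _ = _ := by ring
  suffices h : IsIntegral ℤ (x * z) by
    have : x = x * z * z := by rw [mul_assoc, ← sq, hz2, mul_one]
    rw [this]; exact h.mul hzi
  by_cases hxz : x * z = z
  · rw [hxz]; exact hzi
  refine isIntegral_of_isRoot hgL ?_
  rw [← b.charpoly_mat, ← hM]
  -- Chosen so that `(c, y, 0)` is an eigenvector of `g`: the top row asks for `z c + v · y = x z
  -- c`, solvable as `x z ≠ z`.
  set c : ℂ := (∑ j, M 0 (mid j) * y j) / (x * z - z) with hc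
  have hcz : c * (x * z - z) = ∑ j, M 0 (mid j) * y j := div_mul_cancel₀ _ (sub_ne_zero.2 hxz)
  set v : Fin (m + 2) → ℂ := Fin.snoc (Fin.cons c y : Fin (m + 1) → ℂ) 0 with hv
  have v0 : v 0 = c := by
    have : (0 : Fin (m + 2)) = Fin.castSucc 0 := rfl
    rw [hv, this, Fin.snoc_castSucc, Fin.cons_zero]
  have vm : ∀ i, v (mid i) = y i := fun i => by rw [hv, mid, Fin.snoc_castSucc, Fin.cons_succ]
  have vl : v (Fin.last (m + 1)) = 0 := by rw [hv, Fin.snoc_last]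
  have hvne : v ≠ 0 := by
    obtain ⟨i, hi⟩ := Function.ne_iff.1 hy0
    exact Function.ne_iff.2 ⟨mid i, by rw [vm]; exact hi⟩
  refine isRoot_charpoly_of_mulVec hvne ?_
  ext i
  revert i
  refine index_cases ?_ (fun i => ?_) ?_ <;>
    rw [Matrix.mulVec, dotProduct, sum_index, Pi.smul_apply, smul_eq_mul]
  · simp only [v0, vm, vl, huz]
    linear_combination -hcz
  · simp only [v0, vm, vl, hU.mid_zero, hX]; ring
  · simp [v0, vm, vl, hU.last_zero, hU.last_mid]

/-- Kronecker makes every eigenvalue a root of unity; a common exponent annihilates `R - 1` after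
raising to that power, by definiteness of `B`. -/
theorem exists_rotation_pow_eq_one (hsq : Squarefree D) (hD : D < -3) (b : CuspBasis L)
    (hg : g ∈ lineStabilizer L b.e) (hgL : g ∈ L.unitaryGroup) :
    ∃ N : ℕ, 0 < N ∧ b.rotation g ^ N = 1 := by
  have hun := b.rotation_unitary (by omega) hg hgL
  obtain ⟨q, hq⟩ := b.exists_charpoly_rotation hgL
  have hroot : ∀ x, aeval x q = 0 ↔ (b.rotation g).charpoly.IsRoot x := fun x => by
    rw [← hq, Polynomial.IsRoot, eval_map_algebraMap]
  have h1 : ∀ x, ∃ n : ℕ, 0 < n ∧ ((b.rotation g).charpoly.IsRoot x → x ^ n = 1) := fun x => by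
    by_cases hx : (b.rotation g).charpoly.IsRoot x
    · obtain ⟨n, hn, hxn⟩ := exists_pow_eq_one_of_roots (by omega) q
        (fun y hy => norm_eq_one_of_isRoot b.midGram_definite hun ((hroot y).1 hy))
        (b.isIntegral_of_isRoot_rotation hsq hD hg hgL hx) ((hroot x).2 hx)
      exact ⟨n, hn, fun _ => hxn⟩
    · exact ⟨1, one_pos, fun h => absurd h hx⟩
  choose n hn hxn using h1
  refine ⟨∏ x ∈ (b.rotation g).charpoly.roots.toFinset, n x,
    Finset.prod_pos fun x _ => hn x, pow_eq_one_of_roots b.midGram_definite hun fun x hx => ?_⟩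
  have hmem : x ∈ (b.rotation g).charpoly.roots.toFinset := by
    rw [Multiset.mem_toFinset, mem_roots (Matrix.charpoly_monic _).ne_zero]; exact hx
  obtain ⟨k, hk⟩ := Finset.dvd_prod_of_mem n hmem
  rw [hk, pow_mul, hxn x hx, one_pow]

/-! ### Powers of an element fixing a boundary point -/

theorem mulVec_homog_mid (b : CuspBasis L) (hg : g ∈ lineStabilizer L b.e)
    (p : ℂ × (Fin m → ℂ)) (i : Fin m) : (b.mat g *ᵥ homog p) (mid i) =
      ∑ j, b.mat g (mid i) (mid j) * p.2 j + b.mat g (mid i) (Fin.last (m + 1)) := by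
  rw [Matrix.mulVec, dotProduct, sum_index]
  simp [(b.isUpper_mat hg).mid_zero, homog_last, homog_mid]

theorem mulVec_homog_last (b : CuspBasis L) (hg : g ∈ lineStabilizer L b.e)
    (p : ℂ × (Fin m → ℂ)) : (b.mat g *ᵥ homog p) (Fin.last (m + 1)) =
      b.mat g (Fin.last (m + 1)) (Fin.last (m + 1)) := by
  rw [Matrix.mulVec, dotProduct, sum_index]
  simp [(b.isUpper_mat hg).last_zero, (b.isUpper_mat hg).last_mid, homog_last]

theorem mulVec_homog_zero (b : CuspBasis L) (hg : g ∈ lineStabilizer L b.e)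
    (p : ℂ × (Fin m → ℂ)) : (b.mat g *ᵥ homog p) 0 = b.mat g 0 0 * p.1 +
      b.mat g (Fin.last (m + 1)) (Fin.last (m + 1)) * b.twist g p.2 := by
  rw [twist, mul_div_cancel₀ _ (b.mat_last_ne_zero hg), Matrix.mulVec, dotProduct, sum_index]
  simp [homog_last, homog_mid, homog_zero, add_assoc]

/-- Over a fixed boundary point `w₀`, the equality `u = z` makes `g` a pure translation of `α` by
the twist; this is why twists add under powers. -/
theorem mulVec_homog_of_fixed (hD : D < 0) (b : CuspBasis L)
    (hg : g ∈ lineStabilizer L b.e) (hgL : g ∈ L.unitaryGroup) {w₀ : Fin m → ℂ}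
    (hfix : b.toroidalAction Γ g (0, w₀) = (0, w₀)) (α : ℂ) :
    b.mat g *ᵥ homog (α, w₀) =
      b.mat g (Fin.last (m + 1)) (Fin.last (m + 1)) • homog (α + b.twist g w₀, w₀) := by
  ext i
  revert i
  refine index_cases ?_ (fun i => ?_) ?_
  · rw [b.mulVec_homog_zero hg, b.mat_zero_zero_eq hD hg hgL, Pi.smul_apply, homog_zero,
      smul_eq_mul]
    ring
  · have h := congrFun (congrArg Prod.snd hfix) i
    simp only [toroidalAction] at h
    rw [div_eq_iff (b.mat_last_ne_zero hg)] at h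
    rw [b.mulVec_homog_mid hg, Pi.smul_apply, homog_mid, smul_eq_mul, h, mul_comm]
  · rw [b.mulVec_homog_last hg, Pi.smul_apply, homog_last, smul_eq_mul, mul_one]

theorem pow_mulVec_homog (hD : D < 0) (b : CuspBasis L)
    (hg : g ∈ lineStabilizer L b.e) (hgL : g ∈ L.unitaryGroup) {w₀ : Fin m → ℂ}
    (hfix : b.toroidalAction Γ g (0, w₀) = (0, w₀)) (k : ℕ) :
    b.mat (g ^ k) *ᵥ homog (0, w₀) =
      b.mat (g ^ k) (Fin.last (m + 1)) (Fin.last (m + 1)) • homog (k * b.twist g w₀, w₀) := by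
  rw [mat_pow, (b.isUpper_mat hg).pow_last_last]
  induction k with
  | zero => simp
  | succ k ih =>
    rw [pow_succ', ← Matrix.mulVec_mulVec, ih, Matrix.mulVec_smul,
      b.mulVec_homog_of_fixed hD hg hgL hfix, smul_smul, pow_succ]
    congr 3
    push_cast; ring

theorem twist_pow (hD : D < 0) (b : CuspBasis L)
    (hg : g ∈ lineStabilizer L b.e) (hgL : g ∈ L.unitaryGroup) {w₀ : Fin m → ℂ}
    (hfix : b.toroidalAction Γ g (0, w₀) = (0, w₀)) (k : ℕ) :
    b.twist (g ^ k) w₀ = k * b.twist g w₀ := by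
  have h := congrFun (b.pow_mulVec_homog hD hg hgL hfix k) 0
  rw [b.mulVec_homog_zero (pow_mem hg k), mul_zero, zero_add, Pi.smul_apply, homog_zero,
    smul_eq_mul] at h
  exact mul_left_cancel₀ (b.mat_last_ne_zero (pow_mem hg k)) h

/-- Some power of an element of `N(F)_ℤ` fixing a boundary point is a translation in `U(F)`. -/
theorem exists_pow_eq_translation (hsq : Squarefree D) (hD : D < -3) (b : CuspBasis L)
    (hg : g ∈ lineStabilizer L b.e) (hgL : g ∈ L.unitaryGroup) {w₀ : Fin m → ℂ}
    (hfix : b.toroidalAction Γ g (0, w₀) = (0, w₀)) :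
    ∃ N : ℕ, 0 < N ∧ b.rotation g ^ N = 1 ∧ g ^ N ∈ centerUnipotent L b.e ∧
      b.twist (g ^ N) w₀ = b.mat (g ^ N) 0 (Fin.last (m + 1)) ∧
      ∃ x : ℝ, b.mat (g ^ N) 0 (Fin.last (m + 1)) = Complex.I * b.a * (x : ℂ) := by
  obtain ⟨n, hn, hrn⟩ := b.exists_rotation_pow_eq_one hsq hD hg hgL
  have hD0 : D < 0 := by omega
  -- The exponent is doubled to remove the sign `z = ±1`.
  have hrot : b.rotation g ^ (2 * n) = 1 := by rw [mul_comm, pow_mul, hrn, one_pow]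
  refine ⟨2 * n, by omega, hrot, ?_⟩
  have hgN := pow_mem hg (2 * n)
  have hU := b.isUpper_mat hgN
  have hz : b.mat (g ^ (2 * n)) (Fin.last (m + 1)) (Fin.last (m + 1)) = 1 := by
    rw [mat_pow, (b.isUpper_mat hg).pow_last_last, pow_mul, b.mat_last_sq hsq hD hg hgL, one_pow]
  have hu : b.mat (g ^ (2 * n)) 0 0 = 1 := by
    rw [b.mat_zero_zero_eq hD0 hgN (pow_mem hgL _), hz]
  have hX : (b.mat (g ^ (2 * n))).submatrix mid mid = 1 := by
    have h := b.rotation_pow hg (2 * n)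
    rwa [hrot, rotation, hz, inv_one, one_smul] at h
  have hXij : ∀ i j, b.mat (g ^ (2 * n)) (mid i) (mid j) = (1 : Matrix (Fin m) (Fin m) ℂ) i j :=
    fun i j => congrFun (congrFun hX i) j
  -- With `X = 1` and `z = 1` the boundary action is `w ↦ w + y`, which fixes `w₀` only if `y = 0`.
  have hy : ∀ i, b.mat (g ^ (2 * n)) (mid i) (Fin.last (m + 1)) = 0 := fun i => by
    have h := congrFun (b.pow_mulVec_homog hD0 hg hgL hfix (2 * n)) (mid i)
    rw [b.mulVec_homog_mid hgN, hz, one_smul, homog_mid] at h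
    have h1 : ∑ j, b.mat (g ^ (2 * n)) (mid i) (mid j) * w₀ j = w₀ i := by
      simp [hXij, Matrix.one_apply]
    rw [h1] at h
    simpa using h
  have hv := b.mat_zero_mid_eq_zero hgN hy
  refine ⟨b.mem_centerUnipotent hgN (w := b.mat (g ^ (2 * n)) 0 (Fin.last (m + 1))) ?_, ?_, ?_⟩
  · ext i j
    revert i j
    refine index_cases ?_ (fun i => ?_) ?_ <;> refine index_cases ?_ (fun j => ?_) ?_ <;>
      simp [hu, hz, hv, hy, hXij, hU.mid_zero, hU.last_zero, hU.last_mid, mid_ne_zero,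
        mid_ne_last, (mid_ne_zero _).symm, (mid_ne_last _).symm, zero_ne_last.symm,
        Matrix.one_apply, mid_injective.eq_iff]
  · rw [twist, hz]; simp [hv]
  · have h := b.mat_last_last_eq hgN hz
    set w := b.mat (g ^ (2 * n)) 0 (Fin.last (m + 1))
    have h0 : (fun i => b.mat (g ^ (2 * n)) (mid i) (Fin.last (m + 1))) = 0 := funext hy
    rw [h0, Matrix.mulVec_zero, dotProduct_zero, add_zero] at h
    have ha := b.a_ne_zero
    have ha' : (starRingEnd ℂ) b.a ≠ 0 := star_ne_zero.2 ha
    have hre : (w / (Complex.I * b.a)).im = 0 := by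
      rw [← Complex.conj_eq_iff_im]
      rw [map_div₀, map_mul, Complex.conj_I]
      have hI := Complex.I_ne_zero
      rw [div_eq_div_iff (mul_ne_zero (neg_ne_zero.2 hI) ha') (mul_ne_zero hI ha)]
      rw [Complex.star_def] at h
      linear_combination Complex.I * h
    refine ⟨(w / (Complex.I * b.a)).re, ?_⟩
    have h1 : ((w / (Complex.I * b.a)).re : ℂ) = w / (Complex.I * b.a) :=
      Complex.ext (by simp) (by simp [hre])
    rw [h1, mul_div_cancel₀ _ (mul_ne_zero Complex.I_ne_zero ha)]

end CuspBasis

/-! ### Block diagonal endomorphisms and quasi-reflections -/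

section LinearAlgebra

/-- The endomorphism `(θ, w) ↦ (t θ, R w)`. -/
noncomputable def blockEnd (t : ℂ) (R : Matrix (Fin m) (Fin m) ℂ) :
    Module.End ℂ (ℂ × (Fin m → ℂ)) :=
  (t • LinearMap.id).prodMap (Matrix.toLin' R)

theorem blockEnd_apply (t : ℂ) (R : Matrix (Fin m) (Fin m) ℂ) (p : ℂ × (Fin m → ℂ)) :
    blockEnd t R p = (t * p.1, R *ᵥ p.2) := rfl

theorem blockEnd_pow (t : ℂ) (R : Matrix (Fin m) (Fin m) ℂ) (k : ℕ) :
    blockEnd t R ^ k = blockEnd (t ^ k) (R ^ k) := by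
  induction k with
  | zero => refine LinearMap.ext fun p => ?_; simp [blockEnd_apply]
  | succ k ih =>
    refine LinearMap.ext fun p => ?_
    rw [pow_succ, Module.End.mul_apply, ih, blockEnd_apply, blockEnd_apply, blockEnd_apply,
      Matrix.mulVec_mulVec, ← pow_succ, pow_succ t, mul_assoc]

theorem isOfFinOrder_blockEnd {t : ℂ} {R : Matrix (Fin m) (Fin m) ℂ} {N : ℕ} (hN : 0 < N)
    (ht : t ^ N = 1) (hR : R ^ N = 1) : IsOfFinOrder (blockEnd t R) := by
  refine isOfFinOrder_iff_pow_eq_one.2 ⟨N, hN, ?_⟩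
  rw [blockEnd_pow, ht, hR]
  refine LinearMap.ext fun p => ?_
  simp [blockEnd_apply]

theorem roots_charpoly_blockEnd (t : ℂ) (R : Matrix (Fin m) (Fin m) ℂ) :
    (blockEnd t R).charpoly.roots = t ::ₘ R.charpoly.roots := by
  have h1 : (t • LinearMap.id : ℂ →ₗ[ℂ] ℂ).charpoly = X - C t := by
    have h2 : (t • LinearMap.id : ℂ →ₗ[ℂ] ℂ) =
        Matrix.toLin (Module.Basis.singleton Unit ℂ) (Module.Basis.singleton Unit ℂ)
          (Matrix.of fun _ _ => t) := by
      ext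
      simp [Matrix.toLin_apply, Matrix.mulVec, dotProduct]
    rw [h2, LinearMap.charpoly, ← LinearMap.charpoly_def, Matrix.charpoly_toLin, Matrix.charpoly]
    simp [Matrix.det_unique]
  rw [blockEnd, LinearMap.charpoly_prodMap, h1, Matrix.charpoly_toLin',
    roots_mul (mul_ne_zero (X_sub_C_ne_zero t) (Matrix.charpoly_monic R).ne_zero), roots_X_sub_C]
  rfl

theorem isQuasiReflection_blockEnd_one {t : ℂ} {N : ℕ} (hN : 0 < N) (ht : t ^ N = 1)
    (ht1 : t ≠ 1) : IsQuasiReflection (blockEnd t (1 : Matrix (Fin m) (Fin m) ℂ)) := by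
  refine ⟨isOfFinOrder_blockEnd hN ht (one_pow N), ?_⟩
  have h : LinearMap.range (blockEnd t (1 : Matrix (Fin m) (Fin m) ℂ) - 1) =
      Submodule.span ℂ {((1, 0) : ℂ × (Fin m → ℂ))} := by
    ext p
    rw [Submodule.mem_span_singleton, LinearMap.mem_range]
    constructor
    · rintro ⟨q, rfl⟩
      refine ⟨t * q.1 - q.1, ?_⟩
      simp [blockEnd_apply, Prod.ext_iff]
    · rintro ⟨c, rfl⟩
      refine ⟨((t - 1)⁻¹ * c, 0), ?_⟩
      have : t - 1 ≠ 0 := sub_ne_zero.2 ht1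
      rw [LinearMap.sub_apply, blockEnd_apply]
      ext
      · simp; field_simp
      · simp
  rw [h, finrank_span_singleton]
  simp

/-- For an involution `A`, `(1 - A) / 2` is the projection onto the `-1`-eigenspace; its rank is its
trace, here `(m - (m - 2)) / 2 = 1`. -/
theorem isQuasiReflection_blockEnd_involution {R : Matrix (Fin m) (Fin m) ℂ} (hR : R ^ 2 = 1)
    (htr : R.trace = (m : ℂ) - 2) : IsQuasiReflection (blockEnd 1 R) := by
  refine ⟨isOfFinOrder_blockEnd two_pos (one_pow 2) hR, ?_⟩
  set P : Module.End ℂ (ℂ × (Fin m → ℂ)) := (-(1 / 2 : ℂ)) • (blockEnd 1 R - 1) with hP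
  have happ : ∀ p, P p = (0, (1 / 2 : ℂ) • (p.2 - R *ᵥ p.2)) := fun p => by
    rw [hP, LinearMap.smul_apply, LinearMap.sub_apply, blockEnd_apply]
    ext <;> simp
    ring
  have hrange : LinearMap.range P = LinearMap.range (blockEnd 1 R - 1) :=
    LinearMap.range_smul _ _ (by norm_num)
  have hproj : LinearMap.IsProj (LinearMap.range P) P := by
    refine ⟨fun x => LinearMap.mem_range_self P x, ?_⟩
    rintro _ ⟨p, rfl⟩
    rw [happ, happ]
    have h2 : R *ᵥ (R *ᵥ p.2) = p.2 := by
      rw [Matrix.mulVec_mulVec, ← sq, hR, Matrix.one_mulVec]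
    ext i
    · rfl
    · simp only [Matrix.mulVec_smul, Matrix.mulVec_sub, h2, Pi.smul_apply, Pi.sub_apply,
        smul_eq_mul]
      ring
  have htrace := hproj.trace
  have hPp : P = (0 : ℂ →ₗ[ℂ] ℂ).prodMap (Matrix.toLin' ((1 / 2 : ℂ) • (1 - R))) := by
    refine LinearMap.ext fun p => ?_
    rw [happ, LinearMap.prodMap_apply, Matrix.toLin'_apply, Matrix.smul_mulVec, Matrix.sub_mulVec,
      Matrix.one_mulVec]
    rfl
  rw [hPp, LinearMap.trace_prodMap', ← hPp, map_zero, zero_add, Matrix.trace_toLin'_eq,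
    Matrix.trace_smul, Matrix.trace_sub, htr, Matrix.trace_one, Fintype.card_fin] at htrace
  rw [← hrange]
  have : ((1 : ℕ) : ℂ) = (Module.finrank ℂ (LinearMap.range P) : ℂ) := by
    rw [← htrace]; simp
  exact_mod_cast this.symm

end LinearAlgebra

/-! ### The differential at a boundary point -/

theorem CuspBasis.toroidalAction_eq (b : CuspBasis L) (Γ : Subgroup (GL (Fin (m + 2)) ℂ))
    (g : GL (Fin (m + 2)) ℂ) (p : ℂ × (Fin m → ℂ)) :
    b.toroidalAction Γ g p = (p.1 * b.expA Γ (b.twist g p.2), b.rotation g *ᵥ p.2 + fun i =>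
      b.mat g (mid i) (Fin.last (m + 1)) / b.mat g (Fin.last (m + 1)) (Fin.last (m + 1))) := by
  refine Prod.ext rfl (funext fun i => ?_)
  simp only [toroidalAction, Pi.add_apply, Matrix.mulVec, dotProduct, rotation_apply]
  rw [add_div, Finset.sum_div]
  simp only [div_mul_eq_mul_div]

/-- At `θ = 0` the product rule for `θ · exp_a(twist)` loses the term with the derivative of
`exp_a`, so no off-diagonal part remains. -/
theorem CuspBasis.tangentAction_eq (b : CuspBasis L) (Γ : Subgroup (GL (Fin (m + 2)) ℂ))
    (g : GL (Fin (m + 2)) ℂ) (w₀ : Fin m → ℂ) :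
    b.tangentAction Γ g w₀ = blockEnd (b.expA Γ (b.twist g w₀)) (b.rotation g) := by
  have hE : DifferentiableAt ℂ (fun p : ℂ × (Fin m → ℂ) => b.expA Γ (b.twist g p.2)) (0, w₀) := by
    unfold CuspBasis.expA CuspBasis.twist
    fun_prop
  have h1 := (hasFDerivAt_fst (𝕜 := ℂ) (p := ((0, w₀) : ℂ × (Fin m → ℂ)))).mul hE.hasFDerivAt
  have h2 : HasFDerivAt (fun p : ℂ × (Fin m → ℂ) => b.rotation g *ᵥ p.2 + fun i =>
      b.mat g (mid i) (Fin.last (m + 1)) / b.mat g (Fin.last (m + 1)) (Fin.last (m + 1)))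
      ((LinearMap.toContinuousLinearMap (Matrix.toLin' (b.rotation g))).comp
        (ContinuousLinearMap.snd ℂ ℂ (Fin m → ℂ))) (0, w₀) :=
    (((LinearMap.toContinuousLinearMap (Matrix.toLin' (b.rotation g))).comp
        (ContinuousLinearMap.snd ℂ ℂ (Fin m → ℂ))).hasFDerivAt).add_const _
  have h3 := h1.prodMk h2
  have h4 := h3.congr_of_eventuallyEq (f₁ := b.toroidalAction Γ g)
    (Filter.Eventually.of_forall (b.toroidalAction_eq Γ g))
  rw [CuspBasis.tangentAction, h4.fderiv]
  refine LinearMap.ext fun p => ?_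
  rw [blockEnd_apply]
  ext <;> simp

/-! ### The Reid-Tai inequality -/

section ReidTai

theorem sInf_pow_eq_neg_one {l : ℕ} {ζ : ℂ} (hl : 0 < l) (hζ : IsPrimitiveRoot ζ l)
    (h : (-1 : ℂ) ^ l = 1) : ((sInf {k : ℕ | ζ ^ k = -1} : ℕ) : ℝ) / (l : ℝ) = 1 / 2 := by
  obtain ⟨c, hc⟩ : Even l := by
    rwa [neg_one_pow_eq_one_iff_even (by norm_num)] at h
  have h1 : ζ ^ c = -1 := by
    have h2 : ζ ^ c * ζ ^ c = 1 := by rw [← pow_add, ← hc, hζ.pow_eq_one]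
    refine (mul_self_eq_one_iff.1 h2).resolve_left fun h3 => ?_
    have := Nat.le_of_dvd (by omega) ((hζ.pow_eq_one_iff_dvd c).1 h3)
    omega
  rw [← h1, sInf_pow_eq hζ (by omega), hc]
  have : (c : ℝ) ≠ 0 := by exact_mod_cast (by omega : c ≠ 0)
  push_cast
  field_simp
  norm_num

/-- The Reid-Tai criterion for `(θ, w) ↦ (t θ, R w)`, where `R` is a nontrivial isometry of finite
order of a definite form and is defined over `ℚ(√D)`. -/
theorem one_le_reidTaiSum_blockEnd (hsq : Squarefree D) (hD : D < -3)
    {B R : Matrix (Fin m) (Fin m) ℂ}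
    (hB : ∀ y : Fin m → ℂ, (star y ⬝ᵥ B *ᵥ y).re ≤ 0 → y = 0) (hRB : Rᴴ * B * R = B)
    {q : (quadField D)[X]} (hq : q.map (algebraMap (quadField D) ℂ) = R.charpoly)
    {t : ℂ} {N : ℕ} (hN : 0 < N) (ht : t ^ N = 1) {l : ℕ} (hl : 0 < l) (hRl : R ^ l = 1)
    (hR1 : R ≠ 1) (hqr : ∀ k : ℕ, ¬ IsQuasiReflection (blockEnd t R ^ k))
    {ζ : ℂ} (hζ : IsPrimitiveRoot ζ l) : 1 ≤ reidTaiSum l ζ (blockEnd t R) := by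
  set f : ℂ → ℝ := fun μ => ((sInf {k : ℕ | ζ ^ k = μ} : ℕ) : ℝ) / (l : ℝ) with hf
  -- This covers the default value `0` when `μ` is not a power of `ζ`, so `t` may be dropped without
  -- knowing `t ^ l = 1`.
  have hf0 : ∀ μ, 0 ≤ f μ := fun μ => by positivity
  have hsum0 : ∀ s : Multiset ℂ, 0 ≤ (s.map f).sum := fun s =>
    Multiset.sum_nonneg fun y hy => by
      obtain ⟨μ, -, rfl⟩ := Multiset.mem_map.1 hy
      exact hf0 μ
  have hle : ∀ {s u : Multiset ℂ}, s ≤ u → (s.map f).sum ≤ (u.map f).sum := fun {s u} h => by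
    obtain ⟨v, rfl⟩ := Multiset.le_iff_exists_add.1 h
    rw [Multiset.map_add, Multiset.sum_add]
    linarith [hsum0 v]
  have hsum : reidTaiSum l ζ (blockEnd t R) = f t + (R.charpoly.roots.map f).sum := by
    rw [reidTaiSum, roots_charpoly_blockEnd, Multiset.map_cons, Multiset.sum_cons]
  have hne := (Matrix.charpoly_monic R).ne_zero
  have hroot : ∀ x, x ∈ R.charpoly.roots ↔ R.charpoly.IsRoot x := fun x => mem_roots hne
  rw [hsum]
  -- An eigenvalue of order at least `3` brings all its conjugates over `K`, which suffice on their
  -- own.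
  by_cases hbig : ∃ x ∈ R.charpoly.roots, x ≠ 1 ∧ x ≠ -1
  · obtain ⟨x, hx, hx1, hx2⟩ := hbig
    have hxl : x ^ l = 1 := isRoot_pow_eq_one hRl ((hroot x).1 hx)
    have hord : 3 ≤ orderOf x := by
      have h0 : 0 < orderOf x := orderOf_pos_iff.2 (isOfFinOrder_iff_pow_eq_one.2 ⟨l, hl, hxl⟩)
      have h1 : orderOf x ≠ 1 := fun h => hx1 (orderOf_eq_one_iff.1 h)
      have h2 : orderOf x ≠ 2 := fun h => by
        have h3 := pow_orderOf_eq_one x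
        rw [h] at h3
        exact (sq_eq_one_iff.1 h3).elim hx1 hx2
      omega
    have hkey := one_le_sum_aroots_minpoly hsq hD (IsPrimitiveRoot.orderOf x) hord hl
      (orderOf_dvd_of_pow_eq_one hxl) hζ
    have hdvd : (minpoly (quadField D) x).map (algebraMap (quadField D) ℂ) ∣ R.charpoly := by
      rw [← hq]
      refine Polynomial.map_dvd _ (minpoly.dvd _ _ ?_)
      rw [← eval_map_algebraMap, hq]
      exact (hroot x).1 hx
    have := hle (Polynomial.roots.le_of_dvd hne hdvd)
    change 1 ≤ (((minpoly (quadField D) x).map (algebraMap (quadField D) ℂ)).roots.map f).sum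
      at hkey
    linarith [hf0 t]
  push Not at hbig
  have hcases : ∀ x ∈ R.charpoly.roots, x = 1 ∨ x = -1 := fun x hx => by
    by_cases h : x = 1
    · exact Or.inl h
    · exact Or.inr (hbig x hx h)
  -- An isometry with `1` as its only eigenvalue would be the identity by definiteness.
  have hmem : (-1 : ℂ) ∈ R.charpoly.roots := by
    by_contra hno
    refine hR1 ?_
    have h1 := pow_eq_one_of_roots (N := 1) hB hRB fun x hx => by
      rcases hcases x ((hroot x).2 hx) with h | h
      · rw [h, one_pow]
      · exact absurd ((hroot x).2 hx) (h ▸ hno)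
    rwa [pow_one] at h1
  have hhalf : f (-1) = 1 / 2 :=
    sInf_pow_eq_neg_one hl hζ (isRoot_pow_eq_one hRl ((hroot _).1 hmem))
  obtain ⟨s, hs⟩ := Multiset.exists_cons_of_mem hmem
  rw [hs, Multiset.map_cons, Multiset.sum_cons, hhalf]
  by_cases hs1 : (-1 : ℂ) ∈ s
  · obtain ⟨u, hu⟩ := Multiset.exists_cons_of_mem hs1
    rw [hu, Multiset.map_cons, Multiset.sum_cons, hhalf]
    linarith [hf0 t, hsum0 u]
  have hR2 : R ^ 2 = 1 := pow_eq_one_of_roots hB hRB fun x hx => by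
    rcases hcases x ((hroot x).2 hx) with h | h <;> rw [h] <;> norm_num
  -- Otherwise the square of the differential is `(t², 1)`, a quasi-reflection.
  have ht2 : t ^ 2 = 1 := by
    by_contra h
    refine hqr 2 ?_
    rw [blockEnd_pow, hR2]
    exact isQuasiReflection_blockEnd_one hN (by rw [← pow_mul, mul_comm, pow_mul, ht, one_pow]) h
  rcases sq_eq_one_iff.1 ht2 with h1 | h1
  · exfalso
    refine hqr 1 ?_
    rw [pow_one, h1]
    refine isQuasiReflection_blockEnd_involution hR2 ?_
    -- Exactly one eigenvalue is `-1`, so the trace is `m - 2` and for `t = 1` the differential is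
    -- itself a quasi-reflection.
    have hs' : s = Multiset.replicate (m - 1) 1 := by
      rw [Multiset.eq_replicate]
      constructor
      · have hcard := (IsAlgClosed.splits R.charpoly).natDegree_eq_card_roots
        rw [Matrix.charpoly_natDegree_eq_dim, Fintype.card_fin, hs, Multiset.card_cons] at hcard
        omega
      · intro x hx
        refine (hcases x (by rw [hs]; exact Multiset.mem_cons_of_mem hx)).resolve_right ?_
        rintro rfl; exact hs1 hx
    have hm : 1 ≤ m := by
      have hcard := (IsAlgClosed.splits R.charpoly).natDegree_eq_card_roots
      rw [Matrix.charpoly_natDegree_eq_dim, Fintype.card_fin, hs, Multiset.card_cons] at hcard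
      omega
    rw [Matrix.trace_eq_sum_roots_charpoly, hs, hs', Multiset.sum_cons, Multiset.sum_replicate,
      nsmul_eq_mul, Nat.cast_sub hm]
    push_cast; ring
  · rw [h1, hhalf]
    linarith [hsum0 s]

end ReidTai

end BallQuotient

/-! ### The main theorem -/

open BallQuotient in
theorem mainTheorem6 {D : ℤ} (hsq : Squarefree D) (hD : D < -3) {m : ℕ}
    (L : BallQuotient.HermitianLattice D (m + 1))
    (Γ : Subgroup (Matrix.GeneralLinearGroup (Fin (m + 2)) ℂ))
    (hΓ : Γ ≤ L.unitaryGroup) (hfin : Γ.relIndex L.unitaryGroup ≠ 0)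
    (b : BallQuotient.CuspBasis L)
    (g : BallQuotient.arithStabilizer L Γ b.e)
    (hnontriv : ¬ Set.EqOn (b.toroidalAction Γ (g : Matrix.GeneralLinearGroup (Fin (m + 2)) ℂ)) id
      (b.partialCompactification Γ))
    (w₀ : Fin m → ℂ)
    (hfix : b.toroidalAction Γ (g : Matrix.GeneralLinearGroup (Fin (m + 2)) ℂ) (0, w₀) = (0, w₀))
    (hqr : ∀ k : ℕ, ¬ BallQuotient.IsQuasiReflection
      (b.tangentAction Γ ((g ^ k : BallQuotient.arithStabilizer L Γ b.e) :
        Matrix.GeneralLinearGroup (Fin (m + 2)) ℂ) w₀)) :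
    IsOfFinOrder (g : BallQuotient.CuspGroup L Γ b.e) ∧
    ∀ ζ : ℂ, IsPrimitiveRoot ζ (orderOf (g : BallQuotient.CuspGroup L Γ b.e)) →
      1 ≤ BallQuotient.reidTaiSum (orderOf (g : BallQuotient.CuspGroup L Γ b.e)) ζ
        (b.tangentAction Γ (g : Matrix.GeneralLinearGroup (Fin (m + 2)) ℂ) w₀) := by
  have hD0 : D < 0 := by omega
  have hgS := g.2.1
  have hgL := hΓ g.2.2
  set h : Matrix.GeneralLinearGroup (Fin (m + 2)) ℂ := g.1
  obtain ⟨N, hN, hrN, hcen, htw, x, hx⟩ := b.exists_pow_eq_translation hsq hD hgS hgL hfix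
  have hfin' : IsOfFinOrder (g : CuspGroup L Γ b.e) := by
    refine isOfFinOrder_iff_pow_eq_one.2 ⟨N, hN, ?_⟩
    rw [← QuotientGroup.mk_pow, QuotientGroup.eq_one_iff]
    exact ⟨hcen, pow_mem g.2.2 N⟩
  refine ⟨hfin', fun ζ hζ => ?_⟩
  set t := b.expA Γ (b.twist h w₀) with ht
  -- `g ^ N` translates `α` by an element of the group on which `exp_a` is trivial.
  have htN : t ^ N = 1 := by
    rw [ht, ← b.expA_nat_mul, ← b.twist_pow hD0 hgS hgL hfix, htw, hx]
    exact b.expA_eq_one ⟨h ^ N, ⟨hcen, pow_mem g.2.2 N⟩, hx⟩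
  -- The relevant power of `g` lies in `U(F)`, whose elements have `X = 1` and `z = 1`.
  have hrl : b.rotation h ^ orderOf (g : CuspGroup L Γ b.e) = 1 := by
    have h1 := pow_orderOf_eq_one (g : CuspGroup L Γ b.e)
    rw [← QuotientGroup.mk_pow, QuotientGroup.eq_one_iff] at h1
    have h2 : h ^ orderOf (g : CuspGroup L Γ b.e) ∈ centerUnipotent L b.e := h1.1
    obtain ⟨-, hz, hX⟩ := b.mat_diagonal_of_unipotent h2.1
    rw [← b.rotation_pow hgS, CuspBasis.rotation, hz, hX, inv_one, one_smul]
  have hpow : ∀ k : ℕ, b.tangentAction Γ (h ^ k) w₀ = blockEnd t (b.rotation h) ^ k := fun k => by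
    rw [b.tangentAction_eq, b.twist_pow hD0 hgS hgL hfix, b.expA_nat_mul, b.rotation_pow hgS,
      blockEnd_pow]
  have hqr' : ∀ k : ℕ, ¬ IsQuasiReflection (blockEnd t (b.rotation h) ^ k) := fun k => by
    rw [← hpow]; exact hqr k
  -- If `R = 1`, excluding quasi-reflections forces `t = 1`. Fixing `w₀` gives `y = 0`, hence `v =
  -- 0`; the twist is then independent of `w` and the action is trivial.
  have hR1 : b.rotation h ≠ 1 := by
    intro hR
    have ht1 : t = 1 := by
      by_contra ht1
      refine hqr' 1 ?_
      rw [hR, pow_one]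
      exact isQuasiReflection_blockEnd_one hN htN ht1
    refine hnontriv fun p _ => ?_
    rw [b.toroidalAction_eq, hR, Matrix.one_mulVec, Prod.mk.injEq] at hfix
    have hshift := add_eq_left.1 hfix.2
    have hy : ∀ i, b.mat h (mid i) (Fin.last (m + 1)) = 0 := fun i =>
      (div_eq_zero_iff.1 (congrFun hshift i)).resolve_right (b.mat_last_ne_zero hgS)
    have hv := b.mat_zero_mid_eq_zero hgS hy
    have htwist : b.twist h p.2 = b.twist h w₀ := by simp [CuspBasis.twist, hv]
    rw [b.toroidalAction_eq, hR, Matrix.one_mulVec, hshift, htwist, ← ht, ht1, mul_one, add_zero]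
    rfl
  obtain ⟨q, hq⟩ := b.exists_charpoly_rotation hgL
  rw [b.tangentAction_eq]
  exact one_le_reidTaiSum_blockEnd hsq hD b.midGram_definite (b.rotation_unitary hD0 hgS hgL) hq
    hN htN hfin'.orderOf_pos hrl hR1 hqr' hζ
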